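/- Let $G=\widetilde{SL}_2$ be the universal covering group of $SL(2,\mathbb R)\cong SU(1,1)$, and let $$e_1=\tfrac12\begin{pmatrix}0&1\\1&0\end{pmatrix},\quad e_2=\tfrac12\begin{pmatrix}0&i\\-i&0\end{pmatrix},\quad e_3=\tfrac12\begin{pmatrix}i/2&0\\0&-i/2\end{pmatrix}$$ be the basis of its Lie algebra $\mathfrak{su}(1,1)$; endow $G$ with the left invariant Riemannian metric for which $e_1,e_2,e_3$ is orthonormal, and with the orientation in which this basis is positive. Let $f:M\to G$ be a smooth immersion of a closed oriented surface, and regard $M$ as a compact Riemann surface whose holomorphic local parameters $z=x+iy$ are conformal for the induced metric. In a local parameter $z$ write $f^{-1}\partial f=\sum_k Z_ke_k$ with $\partial=\frac12(\partial_x-i\partial_y)$. A generating spinor $(\psi_1,\psi_2)$ is a pair of smooth complex functions with $$Z_1=\tfrac i2(\bar\psi_2^2+\psi_1^2),\qquad Z_2=\tfrac12(\bar\psi_2^2-\psi_1^2),\qquad Z_3=\psi_1\bar\psi_2,$$ and its Dirac potentials are continuous complex functions $U,V$ with $$\partial\psi_2+U\psi_1=0,\qquad -\bar\partial\psi_1+V\psi_2=0.$$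 Near every point there are such $\psi$, $U$, $V$, and the local expressions $UV\,dx\wedge dy$ define a 2-form on $M$ that does not depend on the choices; the energy of the surface is $E(M)=\int_M UV\,dx\wedge dy$. Then the energy is well defined and real, and $$E(M)=\frac14\int_M\left(H^2+\frac5{16}\widehat K-\frac14\right)d\mu,$$ where $H$ is the mean curvature (half of the trace of the second fundamental form), $\widehat K$ is the sectional curvature of $G$ along the tangent plane of the surface, and $d\mu$ is the induced area measure; the integrand on the right is integrable. -/

import Mathlib

open scoped ContDiff Manifold Matrix ComplexConjugate

/-- The manifold underlying the universal covering group of `SL(2, ℝ) ≅ SU(1,1)`: pairs `(z, φ)`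
with `z` in the unit disc (a point of the hyperbolic plane) and `φ ∈ ℝ` (the lifted angle of a unit
tangent vector at `z`). -/
def slTildeOpens : TopologicalSpace.Opens (ℂ × ℝ) :=
  ⟨{q | ‖q.1‖ < 1}, isOpen_lt (by fun_prop) continuous_const⟩

/-- The universal covering group of `SL(2, ℝ)`, as an open subset of `ℂ × ℝ`. -/
abbrev SLTilde : Type := slTildeOpens

namespace SLTilde

/-- The base point in the unit disc. -/
def z (g : SLTilde) : ℂ := g.1.1

/-- The lifted angle. -/
def ang (g : SLTilde) : ℝ := g.1.2

theorem norm_z_lt (g : SLTilde) : ‖g.z‖ < 1 := g.2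

theorem ext' {g h : SLTilde} (h1 : g.z = h.z) (h2 : g.ang = h.ang) : g = h :=
  Subtype.ext (Prod.ext h1 h2)

theorem normSq_diff (a u : ℂ) :
    ‖1 + conj a * u‖ ^ 2 - ‖a + u‖ ^ 2 = (1 - ‖a‖ ^ 2) * (1 - ‖u‖ ^ 2) := by
  simp only [← Complex.normSq_eq_norm_sq, Complex.normSq_apply, Complex.add_re, Complex.add_im,
    Complex.mul_re, Complex.mul_im, Complex.conj_re, Complex.conj_im, Complex.one_re,
    Complex.one_im]
  ring

theorem norm_rot (t : ℝ) (w : ℂ) : ‖Complex.exp (t * Complex.I) * w‖ = ‖w‖ := by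
  rw [norm_mul, Complex.norm_exp_ofReal_mul_I, one_mul]

theorem mobius_lt {a u : ℂ} (ha : ‖a‖ < 1) (hu : ‖u‖ < 1) :
    ‖(a + u) / (1 + conj a * u)‖ < 1 := by
  have h := normSq_diff a u
  have h1 : 0 < (1 - ‖a‖ ^ 2) * (1 - ‖u‖ ^ 2) := by
    apply mul_pos <;> nlinarith [norm_nonneg a, norm_nonneg u]
  have h2 : ‖a + u‖ < ‖1 + conj a * u‖ := lt_of_pow_lt_pow_left₀ 2 (norm_nonneg _) (by linarith)
  rw [norm_div, div_lt_one (lt_of_le_of_lt (norm_nonneg _) h2)]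
  exact h2

/-- The fractional linear action on the disc in the first component; in the second component the
angles add up with the continuously lifted correction term. -/
noncomputable instance : Mul SLTilde where
  mul g h :=
    ⟨((g.z + Complex.exp (g.ang * Complex.I) * h.z) /
        (1 + conj g.z * (Complex.exp (g.ang * Complex.I) * h.z)),
      g.ang + h.ang +
        2 * Complex.arg (1 + g.z * conj (Complex.exp (g.ang * Complex.I) * h.z))),
      mobius_lt g.norm_z_lt (by rw [norm_rot]; exact h.norm_z_lt)⟩

noncomputable instance : One SLTilde where
  one := ⟨(0, 0), by simp [slTildeOpens]⟩

noncomputable instance : Inv SLTilde where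
  inv g := ⟨(-(Complex.exp (-g.ang * Complex.I) * g.z), -g.ang), by
    have := norm_rot (-g.ang) g.z
    have h := g.norm_z_lt
    push_cast at this
    change ‖-(Complex.exp (-g.ang * Complex.I) * g.z)‖ < 1
    rw [norm_neg, this]
    exact h⟩

theorem mul_z (g h : SLTilde) : (g * h).z =
    (g.z + Complex.exp (g.ang * Complex.I) * h.z) /
        (1 + conj g.z * (Complex.exp (g.ang * Complex.I) * h.z)) := rfl

theorem mul_ang (g h : SLTilde) : (g * h).ang = g.ang + h.ang +
    2 * Complex.arg (1 + g.z * conj (Complex.exp (g.ang * Complex.I) * h.z)) := rfl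

theorem one_z : (1 : SLTilde).z = 0 := rfl
theorem one_ang : (1 : SLTilde).ang = 0 := rfl
theorem inv_z (g : SLTilde) : (g⁻¹).z = -(Complex.exp (-g.ang * Complex.I) * g.z) := rfl
theorem inv_ang (g : SLTilde) : (g⁻¹).ang = -g.ang := rfl

/-- The covering homomorphism onto `SU(1,1)` (see `mat_mul`); its kernel is `{(0, 4πk) : k ∈ ℤ}` and
its source, disc times line, is simply connected. The matrix covered by `g` is as follows: with `c = (1 - |z|²)^(-1/2)` its first row is
`(c e^{iφ/2}, c z e^{-iφ/2})` and its second row is the conjugate of the reversed first row. -/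
noncomputable def mat (g : SLTilde) : Matrix (Fin 2) (Fin 2) ℂ :=
  let c : ℂ := ((Real.sqrt (1 - ‖g.z‖ ^ 2))⁻¹ : ℝ)
  !![c * Complex.exp (g.ang / 2 * Complex.I), c * g.z * Complex.exp (-(g.ang / 2) * Complex.I);
     c * conj g.z * Complex.exp (g.ang / 2 * Complex.I),
     c * Complex.exp (-(g.ang / 2) * Complex.I)]

theorem pos (g : SLTilde) : 0 < 1 - ‖g.z‖ ^ 2 := by
  nlinarith [norm_nonneg g.z, g.norm_z_lt]

theorem abs_arg_lt {a u : ℂ} (ha : ‖a‖ < 1) (hu : ‖u‖ < 1) :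
    |Complex.arg (1 + a * conj u)| < Real.pi / 2 := by
  rw [Complex.abs_arg_lt_pi_div_two_iff]
  left
  have h1 : ‖a * conj u‖ < 1 := by
    rw [norm_mul, RCLike.norm_conj]
    nlinarith [norm_nonneg a, norm_nonneg u]
  have h2 := (abs_le.1 (Complex.abs_re_le_norm (a * conj u))).1
  rw [Complex.add_re, Complex.one_re]
  linarith

theorem mat_mul (g h : SLTilde) : (g * h).mat = g.mat * h.mat := by
  set a := g.z with ha
  set b := h.z with hb
  set u := Complex.exp (g.ang * Complex.I) * b with hu
  set q := 1 + a * conj u with hq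
  have hau : ‖a‖ < 1 := g.norm_z_lt
  have hub : ‖u‖ = ‖b‖ := norm_rot _ _
  have huu : ‖u‖ < 1 := by rw [hub]; exact h.norm_z_lt
  have hcq : conj q = 1 + conj a * u := by simp [hq]
  have hA : 0 < 1 - ‖a‖ ^ 2 := g.pos
  have hB : 0 < 1 - ‖b‖ ^ 2 := h.pos
  have hd := normSq_diff a u
  rw [← hcq, RCLike.norm_conj, hub] at hd
  have hs : 0 < ‖q‖ := by
    have : 0 < ‖q‖ ^ 2 := by nlinarith [mul_pos hA hB, sq_nonneg ‖a + u‖]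
    exact (sq_pos_iff.1 this).lt_of_le' (norm_nonneg _)
  have hz : (g * h).z = (a + u) / conj q := by rw [hcq]; rfl
  have hang : (g * h).ang = g.ang + h.ang + 2 * Complex.arg q := rfl
  have hc : (Real.sqrt (1 - ‖(g * h).z‖ ^ 2))⁻¹ =
      (Real.sqrt (1 - ‖a‖ ^ 2))⁻¹ * (Real.sqrt (1 - ‖b‖ ^ 2))⁻¹ * ‖q‖ := by
    have : 1 - ‖(g * h).z‖ ^ 2 = (1 - ‖a‖ ^ 2) * (1 - ‖b‖ ^ 2) / ‖q‖ ^ 2 := by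
      rw [hz, norm_div, RCLike.norm_conj, ← hd]
      field_simp
    rw [this, Real.sqrt_div (mul_pos hA hB).le, Real.sqrt_mul hA.le, Real.sqrt_sq hs.le]
    field_simp
  set E := Complex.exp (g.ang / 2 * Complex.I) with hE
  set E' := Complex.exp (h.ang / 2 * Complex.I) with hE'
  set T := Complex.exp (Complex.arg q * Complex.I) with hT
  have e1 : Complex.exp (-(g.ang / 2) * Complex.I) = E⁻¹ := by
    rw [neg_mul, Complex.exp_neg]
  have e2 : Complex.exp (-(h.ang / 2) * Complex.I) = E'⁻¹ := by
    rw [neg_mul, Complex.exp_neg]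
  have e3 : Complex.exp (((g * h).ang : ℝ) / 2 * Complex.I) = E * E' * T := by
    rw [hang, hE, hE', hT, ← Complex.exp_add, ← Complex.exp_add]
    congr 1
    push_cast
    ring
  have e4 : Complex.exp (-(((g * h).ang : ℝ) / 2) * Complex.I) = E⁻¹ * E'⁻¹ * T⁻¹ := by
    rw [neg_mul, Complex.exp_neg, e3, mul_inv, mul_inv]
  have e5 : Complex.exp (g.ang * Complex.I) = E ^ 2 := by
    rw [hE, ← Complex.exp_nat_mul]
    congr 1
    push_cast
    ring
  have hE0 : E ≠ 0 := Complex.exp_ne_zero _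
  have hE'0 : E' ≠ 0 := Complex.exp_ne_zero _
  have hT0 : T ≠ 0 := Complex.exp_ne_zero _
  have cE : conj E = E⁻¹ := by
    rw [hE, ← Complex.exp_conj, ← e1]
    congr 1
    rw [map_mul, map_div₀, Complex.conj_ofReal, Complex.conj_I, map_ofNat]
    ring
  have cT : conj T = T⁻¹ := by
    rw [hT, ← Complex.exp_conj, ← Complex.exp_neg]
    congr 1
    simp
  have hqT : (‖q‖ : ℂ) * T = q := Complex.norm_mul_exp_arg_mul_I q
  have hqT' : (‖q‖ : ℂ) * T⁻¹ = conj q := by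
    conv_rhs => rw [← hqT, map_mul, cT, Complex.conj_ofReal]
  have hu2 : u = E ^ 2 * b := by rw [hu, e5]
  have hcu : conj u = E⁻¹ ^ 2 * conj b := by rw [hu2, map_mul, map_pow, cE]
  have hq0 : q ≠ 0 := norm_pos_iff.1 hs
  have hcq0 : conj q ≠ 0 := (map_ne_zero _).2 hq0
  have hcz : conj ((a + u) / conj q) = (conj a + conj u) / q := by
    rw [map_div₀, map_add, Complex.conj_conj]
  have k1 : q = 1 + a * (E⁻¹ ^ 2 * conj b) := by rw [hq, hcu]
  have k2 : conj q = 1 + conj a * (E ^ 2 * b) := by rw [hcq, hu2]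
  rw [hz] at hc
  simp only [mat, hc, e1, e2, e3, e4, hz, ← ha, ← hb, ← hE, ← hE', hcz]
  clear_value a b u q E E' T
  set c : ℂ := (((Real.sqrt (1 - ‖a‖ ^ 2))⁻¹ : ℝ) : ℂ)
  set c' : ℂ := (((Real.sqrt (1 - ‖b‖ ^ 2))⁻¹ : ℝ) : ℂ)
  have hcc : (((Real.sqrt (1 - ‖a‖ ^ 2))⁻¹ * (Real.sqrt (1 - ‖b‖ ^ 2))⁻¹ * ‖q‖ : ℝ) : ℂ) =
      c * c' * ‖q‖ := by simp only [Complex.ofReal_mul]; rfl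
  rw [hcc]
  clear_value c c'
  have m1 : c * c' * ‖q‖ * (E * E' * T) = c * c' * E * E' * q := by
    conv_rhs => rw [← hqT]
    ring
  have m2 : c * c' * ‖q‖ * (E⁻¹ * E'⁻¹ * T⁻¹) = c * c' * E⁻¹ * E'⁻¹ * conj q := by
    rw [← hqT']; ring
  ext i j
  fin_cases i <;> fin_cases j
  · simp only [Matrix.mul_apply, Fin.sum_univ_two]
    simp
    rw [m1, k1]
    field_simp
  · simp only [Matrix.mul_apply, Fin.sum_univ_two]
    simp
    have : c * c' * ‖q‖ * ((a + u) / conj q) * (E⁻¹ * E'⁻¹ * T⁻¹) =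
        c * c' * E⁻¹ * E'⁻¹ * (a + u) := by
      calc _ = (c * c' * ‖q‖ * (E⁻¹ * E'⁻¹ * T⁻¹)) * ((a + u) / conj q) := by ring
        _ = _ := by rw [m2]; field_simp
    rw [this, hu2]
    field_simp
    ring
  · simp only [Matrix.mul_apply, Fin.sum_univ_two]
    simp
    have : c * c' * ‖q‖ * ((conj a + conj u) / q) * (E * E' * T) =
        c * c' * E * E' * (conj a + conj u) := by
      calc _ = (c * c' * ‖q‖ * (E * E' * T)) * ((conj a + conj u) / q) := by ring
        _ = _ := by rw [m1]; field_simp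
    rw [this, hcu]
    field_simp
  · simp only [Matrix.mul_apply, Fin.sum_univ_two]
    simp
    rw [m2, k2]
    field_simp
    ring

theorem mat_inj {g h : SLTilde} (hm : g.mat = h.mat) (hb : |g.ang - h.ang| < 4 * Real.pi) :
    g = h := by
  have h00 := congrFun (congrFun hm 0) 0
  have h10 := congrFun (congrFun hm 1) 0
  have hg := Real.sqrt_pos.2 g.pos
  have hh := Real.sqrt_pos.2 h.pos
  simp only [mat, Matrix.of_apply, Matrix.cons_val_zero, Matrix.cons_val_one,
    Matrix.cons_val', Matrix.cons_val_fin_one] at h00 h10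
  have n : ∀ x : ℝ, ‖Complex.exp (x / 2 * Complex.I)‖ = 1 := by
    intro x
    have := Complex.norm_exp_ofReal_mul_I (x / 2)
    push_cast at this
    exact this
  have hc : (Real.sqrt (1 - ‖g.z‖ ^ 2))⁻¹ = (Real.sqrt (1 - ‖h.z‖ ^ 2))⁻¹ := by
    have := congrArg norm h00
    rw [norm_mul, norm_mul, n, n, mul_one, mul_one, Complex.norm_real, Complex.norm_real,
      Real.norm_of_nonneg (inv_pos.2 hg).le, Real.norm_of_nonneg (inv_pos.2 hh).le] at this
    exact this
  rw [hc] at h00 h10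
  have hc0 : (((Real.sqrt (1 - ‖h.z‖ ^ 2))⁻¹ : ℝ) : ℂ) ≠ 0 :=
    Complex.ofReal_ne_zero.2 (inv_pos.2 hh).ne'
  have he := mul_left_cancel₀ hc0 h00
  rw [he] at h10
  have hz := mul_left_cancel₀ hc0 (mul_right_cancel₀ (Complex.exp_ne_zero _) h10)
  have hz' : g.z = h.z := (starRingEnd ℂ).injective hz
  refine ext' hz' ?_
  obtain ⟨k, hk⟩ := Complex.exp_eq_exp_iff_exists_int.1 he
  have hk' : g.ang = h.ang + 4 * Real.pi * k := by
    have := congrArg Complex.im hk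
    simp at this
    linarith
  have hk0 : k = 0 := by
    rw [hk'] at hb
    have : |4 * Real.pi * k| < 4 * Real.pi * 1 := by
      simpa [mul_assoc] using hb
    rw [abs_mul, abs_of_pos (by positivity)] at this
    have h1 := lt_of_mul_lt_mul_left this (by positivity)
    have h2 : |k| < 1 := by exact_mod_cast h1
    exact Int.abs_lt_one_iff.1 h2
  rw [hk', hk0]
  simp

noncomputable instance : Group SLTilde :=
  Group.ofLeftAxioms
    (by
      intro a b c
      apply mat_inj
      · simp only [mat_mul, Matrix.mul_assoc]
      · have e : ∀ g h : SLTilde, |(g * h).ang - g.ang - h.ang| < Real.pi := by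
          intro g h
          have := abs_arg_lt g.norm_z_lt
            (u := Complex.exp (g.ang * Complex.I) * h.z) (by rw [norm_rot]; exact h.norm_z_lt)
          rw [mul_ang]
          rw [abs_lt] at this ⊢
          constructor <;> linarith [this.1, this.2]
        have h1 := abs_lt.1 (e (a * b) c)
        have h2 := abs_lt.1 (e a b)
        have h3 := abs_lt.1 (e a (b * c))
        have h4 := abs_lt.1 (e b c)
        rw [abs_lt]
        constructor <;> linarith [h1.1, h1.2, h2.1, h2.2, h3.1, h3.2, h4.1, h4.2])
    (by
      intro a
      apply ext'
      · simp [mul_z, one_z, one_ang]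
      · simp [mul_ang, one_z, one_ang])
    (by
      intro a
      have hu : ‖Complex.exp (-a.ang * Complex.I) * a.z‖ < 1 := by
        have := norm_rot (-a.ang) a.z
        push_cast at this
        rw [this]; exact a.norm_z_lt
      apply ext'
      · simp [mul_z, one_z, inv_z, inv_ang]
      · simp only [mul_ang, one_ang, inv_z, inv_ang]
        have : 1 + -(Complex.exp (-a.ang * Complex.I) * a.z) *
            conj (Complex.exp ((-a.ang : ℝ) * Complex.I) * a.z) =
            ((1 - ‖Complex.exp (-a.ang * Complex.I) * a.z‖ ^ 2 : ℝ) : ℂ) := by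
          push_cast
          rw [neg_mul, Complex.mul_conj']
          ring
        rw [this, Complex.arg_ofReal_of_nonneg]
        · ring
        · nlinarith [norm_nonneg (Complex.exp (-a.ang * Complex.I) * a.z)])


/-! ### The Lie algebra, its left invariant metric, connection and curvature -/

/-- The basis `e₁, e₂, e₃` of the Lie algebra `su(1,1)`. -/
noncomputable def basis : Fin 3 → Matrix (Fin 2) (Fin 2) ℂ :=
  ![(1 / 2 : ℂ) • !![0, 1; 1, 0],
    (1 / 2 : ℂ) • !![0, Complex.I; -Complex.I, 0],
    (1 / 2 : ℂ) • !![Complex.I / 2, 0; 0, -(Complex.I / 2)]]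

/-- The element of `su(1,1)` with given coordinates in the basis `e₁, e₂, e₃`. -/
noncomputable def ofCoord (x : Fin 3 → ℝ) : Matrix (Fin 2) (Fin 2) ℂ :=
  ∑ k, (x k : ℂ) • basis k

/-- The coordinates of an element of `su(1,1)` in the basis `e₁, e₂, e₃`. -/
def coord (A : Matrix (Fin 2) (Fin 2) ℂ) : Fin 3 → ℝ :=
  ![2 * (A 0 1).re, 2 * (A 0 1).im, 4 * (A 0 0).im]

theorem coord_ofCoord (x : Fin 3 → ℝ) : coord (ofCoord x) = x := by
  ext k
  fin_cases k <;>
    simp [coord, ofCoord, basis, Fin.sum_univ_three] <;>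
    ring

/-! Below, elements of the Lie algebra are represented by their coordinates in `e₁, e₂, e₃`. The
left invariant metric is the one for which this basis is orthonormal, so that the inner product of
two elements of the Lie algebra is the dot product of their coordinates. -/

/-- The Lie bracket (the commutator of matrices). -/
noncomputable def bracket (x y : Fin 3 → ℝ) : Fin 3 → ℝ :=
  coord (ofCoord x * ofCoord y - ofCoord y * ofCoord x)

/-- The structure constants `α i j k = ⟨[eᵢ, eⱼ], eₖ⟩`. -/
noncomputable def structConst (i j k : Fin 3) : ℝ :=
  bracket (Pi.single i 1) (Pi.single j 1) ⬝ᵥ Pi.single k 1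

/-- The Levi-Civita connection `∇_x y` of the left invariant metric, for left invariant `x, y`. -/
noncomputable def nabla (x y : Fin 3 → ℝ) : Fin 3 → ℝ := fun i =>
  ∑ k, ∑ j, x k * y j * ((structConst k j i + structConst i k j + structConst i j k) / 2)

/-- The curvature operator `(∇_y ∇_x - ∇_x ∇_y + ∇_[x,y]) w`. -/
noncomputable def curvature (x y w : Fin 3 → ℝ) : Fin 3 → ℝ :=
  nabla y (nabla x w) - nabla x (nabla y w) + nabla (bracket x y) w

/-- The sectional curvature of the plane spanned by `x` and `y`. -/
noncomputable def sectional (x y : Fin 3 → ℝ) : ℝ :=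
  (curvature x y x ⬝ᵥ y) / ((x ⬝ᵥ x) * (y ⬝ᵥ y) - (x ⬝ᵥ y) ^ 2)

end SLTilde

open SLTilde

/-! ### Local geometry of a parametrized surface

`F : ℂ → SLTilde` is a local parametrization of a surface, with parameter `w = x + iy`; the
coordinate directions `∂/∂x`, `∂/∂y` are `1` and `Complex.I`. -/

/-- The left translation `F⁻¹ dF(v)` of the derivative of `F` at `w` in the direction `v`, as an
element of the Lie algebra. -/
noncomputable def leftDeriv (F : ℂ → SLTilde) (w v : ℂ) : Fin 3 → ℝ :=
  coord ((F w)⁻¹.mat * Matrix.of fun i j => fderiv ℝ (fun p => (F p).mat i j) w v)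

/-- The first fundamental form. -/
noncomputable def firstForm (F : ℂ → SLTilde) (w v₁ v₂ : ℂ) : ℝ :=
  leftDeriv F w v₁ ⬝ᵥ leftDeriv F w v₂

/-- The determinant of the first fundamental form. -/
noncomputable def gramDet (F : ℂ → SLTilde) (w : ℂ) : ℝ :=
  firstForm F w 1 1 * firstForm F w Complex.I Complex.I - firstForm F w 1 Complex.I ^ 2

/-- The left translation of the unit normal vector, with `(∂F/∂x, ∂F/∂y, N)` positively oriented
with respect to `e₁, e₂, e₃`. -/
noncomputable def unitNormal (F : ℂ → SLTilde) (w : ℂ) : Fin 3 → ℝ :=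
  let c := crossProduct (leftDeriv F w 1) (leftDeriv F w Complex.I)
  (Real.sqrt (c ⬝ᵥ c))⁻¹ • c

/-- The left translation of the covariant derivative in the direction `v₁` of the tangent field
`dF(v₂)` along the surface. -/
noncomputable def covDeriv (F : ℂ → SLTilde) (w v₁ v₂ : ℂ) : Fin 3 → ℝ :=
  (fun k => fderiv ℝ (fun p => leftDeriv F p v₂ k) w v₁) +
    nabla (leftDeriv F w v₁) (leftDeriv F w v₂)

/-- The second fundamental form. -/
noncomputable def secondForm (F : ℂ → SLTilde) (w v₁ v₂ : ℂ) : ℝ :=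
  covDeriv F w v₁ v₂ ⬝ᵥ unitNormal F w

/-- The mean curvature: half of the trace of the second fundamental form with respect to the first
fundamental form. -/
noncomputable def meanCurvatureAt (F : ℂ → SLTilde) (w : ℂ) : ℝ :=
  (secondForm F w 1 1 * firstForm F w Complex.I Complex.I
    - 2 * secondForm F w 1 Complex.I * firstForm F w 1 Complex.I
    + secondForm F w Complex.I Complex.I * firstForm F w 1 1) / (2 * gramDet F w)

/-- The sectional curvature of the ambient metric along the tangent plane. -/
noncomputable def tangentSectionalAt (F : ℂ → SLTilde) (w : ℂ) : ℝ :=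
  sectional (leftDeriv F w 1) (leftDeriv F w Complex.I)

/-- `∂ = (∂/∂x - i ∂/∂y)/2`. -/
noncomputable def dz (g : ℂ → ℂ) (w : ℂ) : ℂ :=
  (fderiv ℝ g w 1 - Complex.I * fderiv ℝ g w Complex.I) / 2

/-- `∂̄ = (∂/∂x + i ∂/∂y)/2`. -/
noncomputable def dzbar (g : ℂ → ℂ) (w : ℂ) : ℂ :=
  (fderiv ℝ g w 1 + Complex.I * fderiv ℝ g w Complex.I) / 2

/-- The coordinates `Z₁, Z₂, Z₃` of `F⁻¹ ∂F` in the basis `e₁, e₂, e₃`. -/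
noncomputable def zCoord (F : ℂ → SLTilde) (w : ℂ) (k : Fin 3) : ℂ :=
  ((leftDeriv F w 1 k : ℂ) - Complex.I * (leftDeriv F w Complex.I k : ℂ)) / 2

/-- `(ψ₁, ψ₂)` is a generating spinor on `D` of the surface `F`. -/
def IsGeneratingSpinor (F : ℂ → SLTilde) (D : Set ℂ) (ψ₁ ψ₂ : ℂ → ℂ) : Prop :=
  ContDiffOn ℝ ∞ ψ₁ D ∧ ContDiffOn ℝ ∞ ψ₂ D ∧ ∀ w ∈ D,
    zCoord F w 0 = Complex.I / 2 * (conj (ψ₂ w) ^ 2 + ψ₁ w ^ 2) ∧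
    zCoord F w 1 = 1 / 2 * (conj (ψ₂ w) ^ 2 - ψ₁ w ^ 2) ∧
    zCoord F w 2 = ψ₁ w * conj (ψ₂ w)

/-- `U, V` are continuous potentials on `D` such that `(ψ₁, ψ₂)` satisfies the Dirac equation
`∂ψ₂ + U ψ₁ = 0`, `-∂̄ψ₁ + V ψ₂ = 0`. -/
def IsDiracPotential (D : Set ℂ) (ψ₁ ψ₂ U V : ℂ → ℂ) : Prop :=
  ContinuousOn U D ∧ ContinuousOn V D ∧ ∀ w ∈ D,
    dz ψ₂ w + U w * ψ₁ w = 0 ∧ -dzbar ψ₁ w + V w * ψ₂ w = 0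

/-! ### Surfaces

A surface is a Riemann surface `M` with a smooth conformal immersion `f : M → SLTilde`. -/

section Surface

variable {M : Type*} [TopologicalSpace M] [ChartedSpace ℂ M]

/-- The holomorphic local parameters of `M`. -/
def localParams (M : Type*) [TopologicalSpace M] [ChartedSpace ℂ M] :
    Set (OpenPartialHomeomorph M ℂ) :=
  IsManifold.maximalAtlas 𝓘(ℂ) ω M

/-- The surface in a local parameter. -/
noncomputable def inParam (f : M → SLTilde) (e : OpenPartialHomeomorph M ℂ) : ℂ → SLTilde := f ∘ e.symm

/-- `f` is smooth, and in every holomorphic local parameter the induced metric has the form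
`λ (dx² + dy²)` with `λ > 0`. -/
def IsConformalImmersion (f : M → SLTilde) : Prop :=
  ContMDiff 𝓘(ℝ, ℂ) 𝓘(ℝ, ℂ × ℝ) ∞ f ∧
  ∀ e ∈ localParams M, ∀ w ∈ e.target,
    0 < firstForm (inParam f e) w 1 1 ∧
    firstForm (inParam f e) w 1 1 = firstForm (inParam f e) w Complex.I Complex.I ∧
    firstForm (inParam f e) w 1 Complex.I = 0

/-- The mean curvature of the surface. -/
noncomputable def meanCurvature (f : M → SLTilde) (p : M) : ℝ :=
  meanCurvatureAt (inParam f (chartAt ℂ p)) (chartAt ℂ p p)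

/-- The sectional curvature of the ambient metric along the tangent plane of the surface. -/
noncomputable def tangentSectional (f : M → SLTilde) (p : M) : ℝ :=
  tangentSectionalAt (inParam f (chartAt ℂ p)) (chartAt ℂ p p)

/-- The induced area measure of the surface. In a local parameter it is `√(EG - F²) dx dy`; these
local measures agree on overlaps, so that their least upper bound is the global area measure. -/
noncomputable def areaMeasure [MeasurableSpace M] (f : M → SLTilde) : MeasureTheory.Measure M :=
  ⨆ e ∈ localParams M,
    ((MeasureTheory.volume.restrict e.target).withDensity
      fun w => ENNReal.ofReal (Real.sqrt (gramDet (inParam f e) w))).map e.symm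

/-- `E` is a value of the energy `∫_M U V dx ∧ dy`: the integral of the 2-form given locally by
`U V dx ∧ dy` is computed with a finite cover by local parameters on which there are a generating
spinor and its Dirac potentials, and with a partition of unity subordinate to this cover. -/
def IsEnergy (f : M → SLTilde) (E : ℂ) : Prop :=
  ∃ (n : ℕ) (e : Fin n → OpenPartialHomeomorph M ℂ) (ψ₁ ψ₂ U V : Fin n → ℂ → ℂ)
    (ρ : PartitionOfUnity (Fin n) M Set.univ),
    (∀ i, e i ∈ localParams M ∧
      IsGeneratingSpinor (inParam f (e i)) (e i).target (ψ₁ i) (ψ₂ i) ∧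
      IsDiracPotential (e i).target (ψ₁ i) (ψ₂ i) (U i) (V i)) ∧
    ρ.IsSubordinate (fun i => (e i).source) ∧
    E = ∑ i, ∫ w in (e i).target, (ρ i ((e i).symm w) : ℂ) * (U i w * V i w)

end Surface

namespace SLTilde

/-! ### The Lie algebra -/

/-! Write `X`, `Y` for the left translated coordinate derivatives of a conformal parametrization,
`λ` for the conformal factor, `N` for the unit normal and `Z = (X - iY)/2`. Two equations govern
`∂̄Z`. Its symmetric part is the tension field, which for a conformal immersion is `2HλN`. Its
antisymmetric part is given by the Maurer-Cartan equation. Together they form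
`ConformalOn.structure_eq`.

Conformality says `∑ Z_k² = 0`, and the spinor parametrizes this null cone: `ψ₁²` and the conjugate
of `ψ₂²` are linear in `Z₁, Z₂`, and `λ = (|ψ₁|² + |ψ₂|²)²`. Differentiating these squares with the
structure equation gives the Dirac equations multiplied by `ψ₁` and `ψ₂`, with explicit potentials
(`ConformalOn.spinor_eq`). The factors can be cancelled, since the points where both components are
nonzero are dense: the planes of `e₁, e₂` form a contact distribution, which no piece of surface can
be tangent to, and a similar argument excludes `Z₃ = 0` on an open set altogether. By the same
density continuous potentials are unique, so that `UV` is always `λ` times `1/4 (H² + 5/16 K̂ - 1/4)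
- (5/8) i H N₃`, where `K̂ = 1 - 5 N₃²` (`ConformalOn.potential_mul`).

This density does not depend on the local parameter, so every admissible cover and partition of
unity gives its integral over the area. The imaginary part integrates to zero: `e₃` is a Killing
field, so `2 H N₃` is the divergence of its tangential projection, and `M` is closed
(`integral_meanCurvature_mul_unitNormal`). Local spinors exist because one of the two squares is
nonzero at each point and has a local square root. Hence the set of energy values is nonempty, and
it consists of the stated number. -/

theorem bracket_apply (x y : Fin 3 → ℝ) : bracket x y =
    ![(x 1 * y 2 - x 2 * y 1) / 2, (x 2 * y 0 - x 0 * y 2) / 2, -2 * (x 0 * y 1 - x 1 * y 0)] := by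
  ext k
  fin_cases k <;>
    simp [bracket, coord, ofCoord, basis, Fin.sum_univ_three] <;>
    ring

theorem nabla_apply (x y : Fin 3 → ℝ) : nabla x y =
    ![-(x 1 * y 2) - 3 / 2 * (x 2 * y 1), 3 / 2 * (x 2 * y 0) + x 0 * y 2,
      -(x 0 * y 1) + x 1 * y 0] := by
  ext k
  fin_cases k <;>
    simp [nabla, structConst, bracket_apply, Fin.sum_univ_three, Pi.single_apply, dotProduct] <;>
    ring

/-- The first two terms are `|x × y|²`, the last is `5 (x × y)₃²`. So the sectional curvature
depends only on the angle between the plane's normal and `e₃`: it is `1` on planes containing `e₃`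
and `-4` on the plane of `e₁, e₂`. -/
theorem curvature_dotProduct (x y : Fin 3 → ℝ) : curvature x y x ⬝ᵥ y =
    (x ⬝ᵥ x) * (y ⬝ᵥ y) - (x ⬝ᵥ y) ^ 2 - 5 * (x 0 * y 1 - x 1 * y 0) ^ 2 := by
  simp [curvature, nabla_apply, bracket_apply, dotProduct, Fin.sum_univ_three]
  ring

theorem sectional_of_conformal {x y : Fin 3 → ℝ} {l : ℝ} (hl : 0 < l) (hx : x ⬝ᵥ x = l)
    (hy : y ⬝ᵥ y = l) (hxy : x ⬝ᵥ y = 0) :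
    sectional x y = 1 - 5 * ((x 0 * y 1 - x 1 * y 0) / l) ^ 2 := by
  rw [sectional, curvature_dotProduct, hx, hy, hxy]
  field_simp
  ring

theorem cross_eq (x y : Fin 3 → ℝ) : crossProduct x y =
    ![x 1 * y 2 - x 2 * y 1, x 2 * y 0 - x 0 * y 2, x 0 * y 1 - x 1 * y 0] := by
  rw [cross_apply]

/-- `coord` reads only three real numbers off a matrix. On `su(1,1)`, which the hypotheses describe,
nothing is lost, and this lets `bracket` be computed as a matrix commutator. -/
theorem ofCoord_coord {A : Matrix (Fin 2) (Fin 2) ℂ} (h1 : A 1 1 = conj (A 0 0))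
    (h2 : A 1 0 = conj (A 0 1)) (h3 : A 0 0 + A 1 1 = 0) : ofCoord (coord A) = A := by
  have h4 : (A 0 0).re = 0 := by
    have := congrArg Complex.re h3
    rw [h1] at this
    simp at this
    linarith
  ext i j
  fin_cases i <;> fin_cases j <;> apply Complex.ext <;>
    simp [ofCoord, coord, basis, Fin.sum_univ_three, h1, h2, h4] <;> ring

theorem coord_sub (A B : Matrix (Fin 2) (Fin 2) ℂ) : coord (A - B) = coord A - coord B := by
  ext k
  fin_cases k <;> simp [coord] <;> ring

theorem coord_neg (A : Matrix (Fin 2) (Fin 2) ℂ) : coord (-A) = -coord A := by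
  ext k
  fin_cases k <;> simp [coord]

/-- A vector orthogonal to two orthogonal vectors of the same length is a multiple of their cross
product. -/
theorem eq_smul_cross {x y t : Fin 3 → ℝ} {l : ℝ} (hl : 0 < l) (hx : x ⬝ᵥ x = l)
    (hy : y ⬝ᵥ y = l) (hxy : x ⬝ᵥ y = 0) (htx : t ⬝ᵥ x = 0) (hty : t ⬝ᵥ y = 0) :
    t = (t ⬝ᵥ crossProduct x y / l ^ 2) • crossProduct x y := by
  simp only [cross_eq, dotProduct, Fin.sum_univ_three] at *
  -- Lagrange's identity `|x × y|² = |x|²|y|² - (x·y)²`.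
  have hc : (x 1 * y 2 - x 2 * y 1) ^ 2 + (x 2 * y 0 - x 0 * y 2) ^ 2 +
      (x 0 * y 1 - x 1 * y 0) ^ 2 = l ^ 2 := by
    linear_combination (y 0 * y 0 + y 1 * y 1 + y 2 * y 2) * hx + l * hy
      - (x 0 * y 0 + x 1 * y 1 + x 2 * y 2) * hxy
  ext k
  fin_cases k <;> simp <;> rw [div_mul_eq_mul_div, eq_div_iff (by positivity)]
  · linear_combination (-(t 0)) * hc +
      ((x 2 * y 0 - x 0 * y 2) * x 2 - (x 0 * y 1 - x 1 * y 0) * x 1) * hty -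
      ((x 2 * y 0 - x 0 * y 2) * y 2 - (x 0 * y 1 - x 1 * y 0) * y 1) * htx
  · linear_combination (-(t 1)) * hc +
      ((x 0 * y 1 - x 1 * y 0) * x 0 - (x 1 * y 2 - x 2 * y 1) * x 2) * hty -
      ((x 0 * y 1 - x 1 * y 0) * y 0 - (x 1 * y 2 - x 2 * y 1) * y 2) * htx
  · linear_combination (-(t 2)) * hc +
      ((x 1 * y 2 - x 2 * y 1) * x 1 - (x 2 * y 0 - x 0 * y 2) * x 0) * hty -
      ((x 1 * y 2 - x 2 * y 1) * y 1 - (x 2 * y 0 - x 0 * y 2) * y 0) * htx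

theorem cross_dotProduct_cross_of_conformal {x y : Fin 3 → ℝ} {l : ℝ} (hx : x ⬝ᵥ x = l)
    (hy : y ⬝ᵥ y = l) (hxy : x ⬝ᵥ y = 0) :
    crossProduct x y ⬝ᵥ crossProduct x y = l ^ 2 := by
  simp only [cross_eq, dotProduct, Fin.sum_univ_three] at *
  simp
  linear_combination (y 0 * y 0 + y 1 * y 1 + y 2 * y 2) * hx + l * hy
      - (x 0 * y 0 + x 1 * y 1 + x 2 * y 2) * hxy

end SLTilde

namespace SLTilde

/-! ### Smoothness of the left translated derivative and the Maurer-Cartan equation -/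

theorem mat_one : (1 : SLTilde).mat = 1 := by
  ext i j
  fin_cases i <;> fin_cases j <;> simp [mat, one_z, one_ang]

theorem mat_inv_mul (g : SLTilde) : (g⁻¹).mat * g.mat = 1 := by
  rw [← mat_mul, inv_mul_cancel, mat_one]

theorem mat_mul_inv (g : SLTilde) : g.mat * (g⁻¹).mat = 1 := by
  rw [← mat_mul, mul_inv_cancel, mat_one]

theorem mat_one_one (g : SLTilde) : g.mat 1 1 = conj (g.mat 0 0) := by
  simp [mat, ← Complex.exp_conj, map_ofNat]

theorem mat_one_zero (g : SLTilde) : g.mat 1 0 = conj (g.mat 0 1) := by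
  simp [mat, ← Complex.exp_conj, map_ofNat]

theorem det_mat (g : SLTilde) : g.mat 0 0 * g.mat 1 1 - g.mat 0 1 * g.mat 1 0 = 1 := by
  have h1 : Complex.exp (g.ang / 2 * Complex.I) * Complex.exp (-(g.ang / 2) * Complex.I) = 1 := by
    rw [← Complex.exp_add]; simp
  have h2 : (((Real.sqrt (1 - ‖g.z‖ ^ 2))⁻¹ : ℝ) : ℂ) ^ 2 * (1 - g.z * conj g.z) = 1 := by
    rw [Complex.mul_conj', ← Complex.ofReal_pow, inv_pow, Real.sq_sqrt g.pos.le]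
    have := g.pos.ne'
    norm_cast
    exact inv_mul_cancel₀ this
  simp only [mat, Matrix.of_apply, Matrix.cons_val_zero, Matrix.cons_val_one, Matrix.cons_val',
    Matrix.cons_val_fin_one]
  linear_combination ((((Real.sqrt (1 - ‖g.z‖ ^ 2))⁻¹ : ℝ) : ℂ) ^ 2 * (1 - g.z * conj g.z)) * h1 + h2

theorem mat_inv (g : SLTilde) :
    (g⁻¹).mat = !![g.mat 1 1, -g.mat 0 1; -g.mat 1 0, g.mat 0 0] := by
  have h : !![g.mat 1 1, -g.mat 0 1; -g.mat 1 0, g.mat 0 0] * g.mat = 1 := by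
    have := det_mat g
    ext i j
    fin_cases i <;> fin_cases j <;> simp [Matrix.mul_apply, Fin.sum_univ_two]
    · linear_combination this
    · ring
    · ring
    · linear_combination this
  calc (g⁻¹).mat = (!![g.mat 1 1, -g.mat 0 1; -g.mat 1 0, g.mat 0 0] * g.mat) * (g⁻¹).mat := by
        rw [h, one_mul]
    _ = _ := by rw [mul_assoc, mat_mul_inv, mul_one]

theorem fderiv_mul_add_mul {a b c d : ℂ → ℂ} {w : ℂ} (ha : DifferentiableAt ℝ a w)
    (hb : DifferentiableAt ℝ b w) (hc : DifferentiableAt ℝ c w) (hd : DifferentiableAt ℝ d w)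
    (u : ℂ) : fderiv ℝ (fun p => a p * b p + c p * d p) w u =
      a w * fderiv ℝ b w u + b w * fderiv ℝ a w u +
        (c w * fderiv ℝ d w u + d w * fderiv ℝ c w u) := by
  have h := ((ha.hasFDerivAt.mul hb.hasFDerivAt).add (hc.hasFDerivAt.mul hd.hasFDerivAt)).fderiv
  exact congrArg (fun L => L u) h

theorem fderiv_mul_sub_mul {a b c d : ℂ → ℂ} {w : ℂ} (ha : DifferentiableAt ℝ a w)
    (hb : DifferentiableAt ℝ b w) (hc : DifferentiableAt ℝ c w) (hd : DifferentiableAt ℝ d w)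
    (u : ℂ) : fderiv ℝ (fun p => a p * b p - c p * d p) w u =
      a w * fderiv ℝ b w u + b w * fderiv ℝ a w u -
        (c w * fderiv ℝ d w u + d w * fderiv ℝ c w u) := by
  have h := ((ha.hasFDerivAt.mul hb.hasFDerivAt).sub (hc.hasFDerivAt.mul hd.hasFDerivAt)).fderiv
  exact congrArg (fun L => L u) h

/-- `F : ℂ → SLTilde` is smooth on `D`. -/
def SmoothOn (F : ℂ → SLTilde) (D : Set ℂ) : Prop :=
  ContDiffOn ℝ ∞ (fun w => ((F w).1 : ℂ × ℝ)) D

variable {F : ℂ → SLTilde} {D : Set ℂ} {w u v : ℂ}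

theorem SmoothOn.mat (hF : SmoothOn F D) (i j : Fin 2) :
    ContDiffOn ℝ ∞ (fun p => (F p).mat i j) D := by
  have hz : ContDiffOn ℝ ∞ (fun p => (F p).z) D := contDiff_fst.comp_contDiffOn hF
  have ha : ContDiffOn ℝ ∞ (fun p => ((F p).ang : ℂ)) D :=
    Complex.ofRealCLM.contDiff.comp_contDiffOn (contDiff_snd.comp_contDiffOn hF)
  have hzc : ContDiffOn ℝ ∞ (fun p => conj (F p).z) D :=
    Complex.conjCLE.contDiff.comp_contDiffOn hz
  have hc : ContDiffOn ℝ ∞ (fun p => (((Real.sqrt (1 - ‖(F p).z‖ ^ 2))⁻¹ : ℝ) : ℂ)) D := by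
    refine Complex.ofRealCLM.contDiff.comp_contDiffOn (ContDiffOn.inv (ContDiffOn.sqrt ?_ ?_) ?_)
    · exact contDiffOn_const.sub (hz.norm_sq ℝ)
    · exact fun p _ => (F p).pos.ne'
    · exact fun p _ => (Real.sqrt_pos.2 (F p).pos).ne'
  have he : ContDiffOn ℝ ∞ (fun p => Complex.exp ((F p).ang / 2 * Complex.I)) D :=
    ((ha.div_const 2).mul contDiffOn_const).cexp
  have he' : ContDiffOn ℝ ∞ (fun p => Complex.exp (-((F p).ang / 2) * Complex.I)) D :=
    ((ha.div_const 2).neg.mul contDiffOn_const).cexp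
  fin_cases i <;> fin_cases j
  · exact hc.mul he
  · exact (hc.mul hz).mul he'
  · exact (hc.mul hzc).mul he
  · exact hc.mul he'

/-- `F⁻¹ dF(v)` as a matrix. -/
noncomputable def leftMat (F : ℂ → SLTilde) (v w : ℂ) : Matrix (Fin 2) (Fin 2) ℂ :=
  (F w)⁻¹.mat * Matrix.of fun i j => fderiv ℝ (fun p => (F p).mat i j) w v

theorem leftDeriv_eq (F : ℂ → SLTilde) (w v : ℂ) : leftDeriv F w v = coord (leftMat F v w) := rfl

theorem SmoothOn.inv_mat (hF : SmoothOn F D) (i j : Fin 2) :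
    ContDiffOn ℝ ∞ (fun p => ((F p)⁻¹).mat i j) D := by
  simp only [mat_inv]
  fin_cases i <;> fin_cases j
  · exact hF.mat 1 1
  · exact (hF.mat 0 1).neg
  · exact (hF.mat 1 0).neg
  · exact hF.mat 0 0

theorem SmoothOn.fderiv_mat (hF : SmoothOn F D) (hD : IsOpen D) (v : ℂ) (i j : Fin 2) :
    ContDiffOn ℝ ∞ (fun q => fderiv ℝ (fun p => (F p).mat i j) q v) D :=
  ((hF.mat i j).fderiv_of_isOpen hD (by simp)).clm_apply contDiffOn_const

theorem SmoothOn.leftMat (hF : SmoothOn F D) (hD : IsOpen D) (v : ℂ) (i j : Fin 2) :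
    ContDiffOn ℝ ∞ (fun p => leftMat F v p i j) D := by
  simp only [SLTilde.leftMat, Matrix.mul_apply, Matrix.of_apply]
  exact ContDiffOn.sum fun k _ => (hF.inv_mat i k).mul (hF.fderiv_mat hD v k j)

theorem SmoothOn.leftDeriv (hF : SmoothOn F D) (hD : IsOpen D) (v : ℂ) (k : Fin 3) :
    ContDiffOn ℝ ∞ (fun p => leftDeriv F p v k) D := by
  have hr (i j) : ContDiffOn ℝ ∞ (fun p => (SLTilde.leftMat F v p i j).re) D :=
    Complex.reCLM.contDiff.comp_contDiffOn (hF.leftMat hD v i j)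
  have hi (i j) : ContDiffOn ℝ ∞ (fun p => (SLTilde.leftMat F v p i j).im) D :=
    Complex.imCLM.contDiff.comp_contDiffOn (hF.leftMat hD v i j)
  simp only [leftDeriv_eq]
  fin_cases k
  · exact contDiffOn_const.mul (hr 0 1)
  · exact contDiffOn_const.mul (hi 0 1)
  · exact contDiffOn_const.mul (hi 0 0)

/-- The form `F⁻¹ dF` takes values in `su(1,1)`: the conjugation relations come from those of the
group, the vanishing trace from differentiating `det = 1`. -/
theorem leftMat_one_one (hF : SmoothOn F D) (hD : IsOpen D) (hw : w ∈ D) (v : ℂ) :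
    leftMat F v w 1 1 = conj (leftMat F v w 0 0) ∧
    leftMat F v w 1 0 = conj (leftMat F v w 0 1) ∧
    leftMat F v w 0 0 + leftMat F v w 1 1 = 0 := by
  have hd (i j) : DifferentiableAt ℝ (fun p => (F p).mat i j) w :=
    ((hF.mat i j).contDiffAt (hD.mem_nhds hw)).differentiableAt (by simp)
  have hconj (g : ℂ → ℂ) : fderiv ℝ (fun p => conj (g p)) w v = conj (fderiv ℝ g w v) := by
    have := Complex.conjCLE.comp_fderiv (f := g) (x := w)
    exact congrArg (fun L => L v) this
  have h11 : fderiv ℝ (fun p => (F p).mat 1 1) w v = conj (fderiv ℝ (fun p => (F p).mat 0 0) w v) := by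
    rw [← hconj]
    simp only [mat_one_one]
  have h10 : fderiv ℝ (fun p => (F p).mat 1 0) w v = conj (fderiv ℝ (fun p => (F p).mat 0 1) w v) := by
    rw [← hconj]
    simp only [mat_one_zero]
  have hdet : fderiv ℝ (fun p => (F p).mat 0 0 * (F p).mat 1 1 - (F p).mat 0 1 * (F p).mat 1 0) w v
      = 0 := by
    simp only [det_mat]
    simp
  rw [fderiv_mul_sub_mul (hd _ _) (hd _ _) (hd _ _) (hd _ _)] at hdet
  simp only [leftMat, mat_inv, Matrix.mul_apply, Fin.sum_univ_two, Matrix.of_apply,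
    Matrix.cons_val_zero, Matrix.cons_val_one, Matrix.cons_val', Matrix.cons_val_fin_one]
  refine ⟨?_, ?_, ?_⟩
  · rw [h11, h10, mat_one_one, mat_one_zero]
    simp
    ring
  · rw [h11, h10, mat_one_one, mat_one_zero]
    simp
    ring
  · linear_combination hdet

theorem ofCoord_leftDeriv (hF : SmoothOn F D) (hD : IsOpen D) (hw : w ∈ D) (v : ℂ) :
    ofCoord (leftDeriv F w v) = leftMat F v w := by
  obtain ⟨h1, h2, h3⟩ := leftMat_one_one hF hD hw v
  exact ofCoord_coord h1 h2 h3

theorem fderiv_leftDeriv (hF : SmoothOn F D) (hD : IsOpen D) (hw : w ∈ D) (u v : ℂ) :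
    (fun k => fderiv ℝ (fun p => leftDeriv F p v k) w u) =
      coord (Matrix.of fun i j => fderiv ℝ (fun p => leftMat F v p i j) w u) := by
  have hd (i j) : DifferentiableAt ℝ (fun p => leftMat F v p i j) w :=
    ((hF.leftMat hD v i j).contDiffAt (hD.mem_nhds hw)).differentiableAt (by simp)
  have hr (c : ℝ) (i j) : fderiv ℝ (fun p => c * (leftMat F v p i j).re) w u =
      c * (fderiv ℝ (fun p => leftMat F v p i j) w u).re := by
    have h := ((Complex.reCLM.hasFDerivAt.comp w (hd i j).hasFDerivAt).const_mul c).fderiv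
    exact congrArg (fun L => L u) h
  have hi (c : ℝ) (i j) : fderiv ℝ (fun p => c * (leftMat F v p i j).im) w u =
      c * (fderiv ℝ (fun p => leftMat F v p i j) w u).im := by
    have h := ((Complex.imCLM.hasFDerivAt.comp w (hd i j).hasFDerivAt).const_mul c).fderiv
    exact congrArg (fun L => L u) h
  ext k
  fin_cases k
  · exact hr 2 0 1
  · exact hi 2 0 1
  · exact hi 4 0 0

theorem fderiv_leftMat (hF : SmoothOn F D) (hD : IsOpen D) (hw : w ∈ D) (u v : ℂ) :
    (Matrix.of fun i j => fderiv ℝ (fun p => leftMat F v p i j) w u) =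
      (Matrix.of fun i j => fderiv ℝ (fun p => ((F p)⁻¹).mat i j) w u) *
        (Matrix.of fun i j => fderiv ℝ (fun p => (F p).mat i j) w v) +
      (F w)⁻¹.mat *
        (Matrix.of fun i j => fderiv ℝ (fun q => fderiv ℝ (fun p => (F p).mat i j) q v) w u) := by
  have h1 (i j) : DifferentiableAt ℝ (fun p => ((F p)⁻¹).mat i j) w :=
    ((hF.inv_mat i j).contDiffAt (hD.mem_nhds hw)).differentiableAt (by simp)
  have h2 (i j) : DifferentiableAt ℝ (fun q => fderiv ℝ (fun p => (F p).mat i j) q v) w :=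
    ((hF.fderiv_mat hD v i j).contDiffAt (hD.mem_nhds hw)).differentiableAt (by simp)
  ext i j
  simp only [leftMat, Matrix.mul_apply, Matrix.of_apply, Matrix.add_apply, Fin.sum_univ_two]
  rw [fderiv_mul_add_mul (h1 _ _) (h2 _ _) (h1 _ _) (h2 _ _)]
  ring

theorem fderiv_inv_mat (hF : SmoothOn F D) (hD : IsOpen D) (hw : w ∈ D) (u : ℂ) :
    (Matrix.of fun i j => fderiv ℝ (fun p => ((F p)⁻¹).mat i j) w u) * (F w).mat +
      (F w)⁻¹.mat * (Matrix.of fun i j => fderiv ℝ (fun p => (F p).mat i j) w u) = 0 := by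
  have h1 (i j) : DifferentiableAt ℝ (fun p => ((F p)⁻¹).mat i j) w :=
    ((hF.inv_mat i j).contDiffAt (hD.mem_nhds hw)).differentiableAt (by simp)
  have h2 (i j) : DifferentiableAt ℝ (fun p => (F p).mat i j) w :=
    ((hF.mat i j).contDiffAt (hD.mem_nhds hw)).differentiableAt (by simp)
  ext i j
  have h : fderiv ℝ (fun p => (((F p)⁻¹).mat * (F p).mat) i j) w u = 0 := by
    simp only [mat_inv_mul]
    simp
  simp only [Matrix.mul_apply, Fin.sum_univ_two] at h
  rw [fderiv_mul_add_mul (h1 _ _) (h2 _ _) (h1 _ _) (h2 _ _)] at h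
  simp only [Matrix.mul_apply, Matrix.of_apply, Matrix.add_apply, Fin.sum_univ_two,
    Matrix.zero_apply]
  linear_combination h

/-- The Maurer-Cartan equation. -/
theorem maurerCartan (hF : SmoothOn F D) (hD : IsOpen D) (hw : w ∈ D) (u v : ℂ) (k : Fin 3) :
    fderiv ℝ (fun p => leftDeriv F p v k) w u - fderiv ℝ (fun p => leftDeriv F p u k) w v +
      bracket (leftDeriv F w u) (leftDeriv F w v) k = 0 := by
  -- Mixed second derivatives are symmetric, so the second-order terms of `d(F⁻¹ dF)` cancel.
  have hsymm : (Matrix.of fun i j => fderiv ℝ (fun q => fderiv ℝ (fun p => (F p).mat i j) q v) w u)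
      = Matrix.of fun i j => fderiv ℝ (fun q => fderiv ℝ (fun p => (F p).mat i j) q u) w v := by
    ext i j
    have hc : ContDiffAt ℝ ∞ (fun p => (F p).mat i j) w :=
      (hF.mat i j).contDiffAt (hD.mem_nhds hw)
    have h := (hc.isSymmSndFDerivAt (by
      rw [minSmoothness_of_isRCLikeNormedField]
      exact WithTop.coe_le_coe.2 (le_top : (2 : ℕ∞) ≤ ⊤))).eq u v
    have hd : DifferentiableAt ℝ (fderiv ℝ fun p => (F p).mat i j) w :=
      (hc.fderiv_right (m := ∞) (by simp)).differentiableAt (by simp)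
    have e (a b : ℂ) : fderiv ℝ (fun q => fderiv ℝ (fun p => (F p).mat i j) q a) w b =
        fderiv ℝ (fderiv ℝ fun p => (F p).mat i j) w b a := by
      rw [fderiv_clm_apply hd (by fun_prop)]
      simp
    simp only [Matrix.of_apply, e, h]
  -- Differentiating `F⁻¹ F = 1` gives `d(F⁻¹) = -F⁻¹ dF F⁻¹`; this produces the quadratic terms,
  -- hence the commutator.
  have key (a b : ℂ) : (Matrix.of fun i j => fderiv ℝ (fun p => ((F p)⁻¹).mat i j) w a) *
      (Matrix.of fun i j => fderiv ℝ (fun p => (F p).mat i j) w b) =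
      -(leftMat F a w * leftMat F b w) := by
    have h := eq_neg_of_add_eq_zero_left (fderiv_inv_mat hF hD hw a)
    calc _ = ((Matrix.of fun i j => fderiv ℝ (fun p => ((F p)⁻¹).mat i j) w a) * (F w).mat) *
          ((F w)⁻¹.mat * Matrix.of fun i j => fderiv ℝ (fun p => (F p).mat i j) w b) := by
          rw [mul_assoc, ← mul_assoc (F w).mat, mat_mul_inv, one_mul]
      _ = _ := by rw [h, neg_mul]; rfl
  have h : coord (Matrix.of fun i j => fderiv ℝ (fun p => leftMat F v p i j) w u) -
      coord (Matrix.of fun i j => fderiv ℝ (fun p => leftMat F u p i j) w v) +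
      bracket (leftDeriv F w u) (leftDeriv F w v) = 0 := by
    rw [← coord_sub, fderiv_leftMat hF hD hw, fderiv_leftMat hF hD hw, hsymm, key, key, bracket,
      ofCoord_leftDeriv hF hD hw, ofCoord_leftDeriv hF hD hw, add_sub_add_right_eq_sub,
      neg_sub_neg, ← neg_sub, coord_neg, neg_add_cancel]
  rw [← fderiv_leftDeriv hF hD hw, ← fderiv_leftDeriv hF hD hw] at h
  exact congrFun h k

end SLTilde

namespace SLTilde

/-! ### The structure equations of a conformally parametrized surface -/

/-- `F` is a smooth conformal immersion of the open set `D`. -/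
structure ConformalOn (F : ℂ → SLTilde) (D : Set ℂ) : Prop where
  isOpen : IsOpen D
  smoothOn : SmoothOn F D
  conformal : ∀ w ∈ D, 0 < firstForm F w 1 1 ∧
    firstForm F w 1 1 = firstForm F w Complex.I Complex.I ∧ firstForm F w 1 Complex.I = 0

/-- The derivative in the direction `u` of the left translation of `dF(v)`. -/
noncomputable def derivLeft (F : ℂ → SLTilde) (w u v : ℂ) : Fin 3 → ℝ :=
  fun k => fderiv ℝ (fun p => leftDeriv F p v k) w u

/-- The left translation of `∂F/∂x × ∂F/∂y`. -/
noncomputable def areaVector (F : ℂ → SLTilde) (w : ℂ) : Fin 3 → ℝ :=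
  crossProduct (leftDeriv F w 1) (leftDeriv F w Complex.I)

theorem areaVector_eq (F : ℂ → SLTilde) (w : ℂ) : areaVector F w =
    ![leftDeriv F w 1 1 * leftDeriv F w Complex.I 2 - leftDeriv F w 1 2 * leftDeriv F w Complex.I 1,
      leftDeriv F w 1 2 * leftDeriv F w Complex.I 0 - leftDeriv F w 1 0 * leftDeriv F w Complex.I 2,
      leftDeriv F w 1 0 * leftDeriv F w Complex.I 1 -
        leftDeriv F w 1 1 * leftDeriv F w Complex.I 0] := cross_eq _ _

variable {F : ℂ → SLTilde} {D : Set ℂ} {w u v : ℂ}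

namespace ConformalOn

theorem differentiableAt_leftDeriv (h : ConformalOn F D) (hw : w ∈ D) (v : ℂ) (k : Fin 3) :
    DifferentiableAt ℝ (fun p => leftDeriv F p v k) w :=
  ((h.smoothOn.leftDeriv h.isOpen v k).contDiffAt (h.isOpen.mem_nhds hw)).differentiableAt (by simp)

theorem gramDet_eq (h : ConformalOn F D) (hw : w ∈ D) : gramDet F w = firstForm F w 1 1 ^ 2 := by
  obtain ⟨-, h2, h3⟩ := h.conformal w hw
  rw [gramDet, ← h2, h3]
  ring

theorem sqrt_gramDet (h : ConformalOn F D) (hw : w ∈ D) :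
    Real.sqrt (gramDet F w) = firstForm F w 1 1 := by
  rw [h.gramDet_eq hw, Real.sqrt_sq (h.conformal w hw).1.le]

theorem areaVector_sq (h : ConformalOn F D) (hw : w ∈ D) :
    areaVector F w ⬝ᵥ areaVector F w = firstForm F w 1 1 ^ 2 := by
  obtain ⟨h1, h2, h3⟩ := h.conformal w hw
  exact cross_dotProduct_cross_of_conformal rfl h2.symm h3

theorem unitNormal_eq (h : ConformalOn F D) (hw : w ∈ D) :
    unitNormal F w = (firstForm F w 1 1)⁻¹ • areaVector F w := by
  have := h.areaVector_sq hw
  rw [areaVector] at this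
  rw [unitNormal, this, Real.sqrt_sq (h.conformal w hw).1.le, areaVector]

theorem tangentSectionalAt_eq (h : ConformalOn F D) (hw : w ∈ D) :
    tangentSectionalAt F w = 1 - 5 * unitNormal F w 2 ^ 2 := by
  obtain ⟨h1, h2, h3⟩ := h.conformal w hw
  rw [tangentSectionalAt, sectional_of_conformal h1 rfl h2.symm h3, h.unitNormal_eq hw,
    areaVector_eq]
  simp
  ring

theorem fderiv_firstForm (h : ConformalOn F D) (hw : w ∈ D) (u a b : ℂ) :
    fderiv ℝ (fun p => firstForm F p a b) w u =
      derivLeft F w u a ⬝ᵥ leftDeriv F w b + leftDeriv F w a ⬝ᵥ derivLeft F w u b := by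
  have ha (k) := (h.differentiableAt_leftDeriv hw a k).hasFDerivAt
  have hb (k) := (h.differentiableAt_leftDeriv hw b k).hasFDerivAt
  have e := ((((ha 0).mul (hb 0)).add ((ha 1).mul (hb 1))).add ((ha 2).mul (hb 2))).fderiv
  have : (fun p => firstForm F p a b) = fun p => leftDeriv F p a 0 * leftDeriv F p b 0 +
      leftDeriv F p a 1 * leftDeriv F p b 1 + leftDeriv F p a 2 * leftDeriv F p b 2 := by
    ext p
    simp [firstForm, dotProduct, Fin.sum_univ_three]
  rw [this]
  refine (congrArg (fun L => L u) e).trans ?_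
  simp [dotProduct, Fin.sum_univ_three, derivLeft]
  ring

theorem derivLeft_sub (h : ConformalOn F D) (hw : w ∈ D) (k : Fin 3) :
    derivLeft F w Complex.I 1 k = derivLeft F w 1 Complex.I k +
      bracket (leftDeriv F w 1) (leftDeriv F w Complex.I) k := by
  have := maurerCartan h.smoothOn h.isOpen hw 1 Complex.I k
  simp only [derivLeft]
  linarith

theorem meanCurvatureAt_eq (h : ConformalOn F D) (hw : w ∈ D) : meanCurvatureAt F w =
    (covDeriv F w 1 1 + covDeriv F w Complex.I Complex.I) ⬝ᵥ areaVector F w /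
      (2 * firstForm F w 1 1 ^ 2) := by
  obtain ⟨h1, h2, h3⟩ := h.conformal w hw
  simp only [meanCurvatureAt, secondForm]
  rw [← h2, h3, h.gramDet_eq hw, h.unitNormal_eq hw, add_dotProduct]
  simp only [dotProduct_smul, smul_eq_mul]
  field_simp
  ring

/-- The tension field of a conformal immersion is the mean curvature vector. -/
theorem tension_eq (h : ConformalOn F D) (hw : w ∈ D) :
    covDeriv F w 1 1 + covDeriv F w Complex.I Complex.I =
      (2 * meanCurvatureAt F w) • areaVector F w := by
  obtain ⟨h1, h2, h3⟩ := h.conformal w hw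
  have hev := h.isOpen.mem_nhds hw
  have d2 (u : ℂ) : fderiv ℝ (fun p => firstForm F p 1 1) w u =
      fderiv ℝ (fun p => firstForm F p Complex.I Complex.I) w u := by
    rw [Filter.EventuallyEq.fderiv_eq]
    filter_upwards [hev] with p hp using (h.conformal p hp).2.1
  have d3 (u : ℂ) : fderiv ℝ (fun p => firstForm F p 1 Complex.I) w u = 0 := by
    have : fderiv ℝ (fun p => firstForm F p 1 Complex.I) w = fderiv ℝ (fun _ => (0 : ℝ)) w := by
      apply Filter.EventuallyEq.fderiv_eq
      filter_upwards [hev] with p hp using (h.conformal p hp).2.2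
    rw [this]
    simp
  have a1 := d2 1
  have a2 := d2 Complex.I
  have a3 := d3 1
  have a4 := d3 Complex.I
  simp only [h.fderiv_firstForm hw] at a1 a2 a3 a4
  have mc := h.derivLeft_sub hw
  have mc0 := mc 0
  have mc1 := mc 1
  have mc2 := mc 2
  clear d2 d3 mc
  set X := leftDeriv F w 1
  set Y := leftDeriv F w Complex.I
  set t := covDeriv F w 1 1 + covDeriv F w Complex.I Complex.I with ht
  have ht' (k) : t k = derivLeft F w 1 1 k + nabla X X k +
      (derivLeft F w Complex.I Complex.I k + nabla Y Y k) := rfl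
  have t0 := ht' 0
  have t1 := ht' 1
  have t2 := ht' 2
  -- Metric compatibility and vanishing torsion: `⟨∇ₓX, X⟩ = ⟨∇ₓY, Y⟩` from `|X|² = |Y|²`, then `∇ₓY
  -- = ∇_yX`, and `⟨∇_yX, Y⟩ = -⟨X, ∇_yY⟩` from `⟨X, Y⟩ = 0`. The other direction is symmetric.
  have tX : t ⬝ᵥ X = 0 := by
    simp only [dotProduct, Fin.sum_univ_three, bracket_apply, nabla_apply, Matrix.cons_val] at *
    rw [t0, t1, t2]
    rw [mc0, mc1, mc2] at a4
    linear_combination a1 / 2 + a4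
  have tY : t ⬝ᵥ Y = 0 := by
    simp only [dotProduct, Fin.sum_univ_three, bracket_apply, nabla_apply, Matrix.cons_val] at *
    rw [t0, t1, t2]
    rw [mc0, mc1, mc2] at a2
    linear_combination -a2 / 2 + a3
  have hm : meanCurvatureAt F w = t ⬝ᵥ areaVector F w / (2 * firstForm F w 1 1 ^ 2) :=
    h.meanCurvatureAt_eq hw
  rw [eq_smul_cross h1 rfl h2.symm h3 tX tY, hm]
  congr 1
  field_simp
  rfl

/-- This separates the divergence `∂ₓX + ∂_yY`, controlled by the tension field, from the curl `∂_yX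
- ∂ₓY`, controlled by the Maurer-Cartan equation. -/
theorem dzbar_zCoord (h : ConformalOn F D) (hw : w ∈ D) (k : Fin 3) :
    dzbar (fun p => zCoord F p k) w =
      ((derivLeft F w 1 1 k + derivLeft F w Complex.I Complex.I k : ℝ) +
        Complex.I * (derivLeft F w Complex.I 1 k - derivLeft F w 1 Complex.I k : ℝ)) / 4 := by
  have e (v) : HasFDerivAt (fun p => (leftDeriv F p v k : ℂ))
      (Complex.ofRealCLM ∘L fderiv ℝ (fun p => leftDeriv F p v k) w) w :=
    Complex.ofRealCLM.hasFDerivAt.comp w (h.differentiableAt_leftDeriv hw v k).hasFDerivAt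
  have e' := (((e 1).sub ((e Complex.I).const_mul Complex.I)).mul_const (1 / 2 : ℂ)).fderiv
  have : (fun p => zCoord F p k) = fun p => ((leftDeriv F p 1 k : ℂ) -
      Complex.I * (leftDeriv F p Complex.I k : ℂ)) * (1 / 2 : ℂ) := by
    ext p
    rw [zCoord]
    ring
  rw [dzbar, this]
  have e1 (u) := congrArg (fun L : ℂ →L[ℝ] ℂ => L u) e'
  refine (congrArg₂ (fun a b => (a + Complex.I * b) / 2) (e1 1) (e1 Complex.I)).trans ?_
  simp [derivLeft]
  linear_combination -(fderiv ℝ (fun p => leftDeriv F p Complex.I k) w Complex.I : ℂ) *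
    Complex.I_mul_I / 4

/-- With `c = X × Y` the bracket is `-2c + (5/2)(c₁, c₂, 0)`. The first part adds `-i` to `H`. The
second part combines with `∇_X X = (5/2) x₃ (-x₂, x₁, 0)` and its analogue for `Y` into the term
with `conj Z₃`. That term has no `e₃` component, which is what both the density argument and the
divergence argument use. -/
theorem structure_eq (h : ConformalOn F D) (hw : w ∈ D) (k : Fin 3) :
    dzbar (fun p => zCoord F p k) w = (meanCurvatureAt F w - Complex.I) / 2 * areaVector F w k -
      5 / 2 * conj (zCoord F w 2) * (![-zCoord F w 1, zCoord F w 0, 0] : Fin 3 → ℂ) k := by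
  have hT := congrFun (h.tension_eq hw) k
  have hT' : derivLeft F w 1 1 k + nabla (leftDeriv F w 1) (leftDeriv F w 1) k +
      (derivLeft F w Complex.I Complex.I k +
        nabla (leftDeriv F w Complex.I) (leftDeriv F w Complex.I) k) =
      2 * meanCurvatureAt F w * areaVector F w k := hT
  have hC : conj (zCoord F w 2) =
      ((leftDeriv F w 1 2 : ℂ) + Complex.I * (leftDeriv F w Complex.I 2 : ℂ)) / 2 := by
    simp [zCoord, map_ofNat]
  have hs : derivLeft F w 1 1 k + derivLeft F w Complex.I Complex.I k =
      2 * meanCurvatureAt F w * areaVector F w k -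
        nabla (leftDeriv F w 1) (leftDeriv F w 1) k -
        nabla (leftDeriv F w Complex.I) (leftDeriv F w Complex.I) k := by linarith
  rw [h.dzbar_zCoord hw, hs, h.derivLeft_sub hw, add_sub_cancel_left, hC, areaVector_eq,
    nabla_apply, nabla_apply, bracket_apply]
  have hI := Complex.I_mul_I
  fin_cases k <;> simp [zCoord]
  · linear_combination
      (5 / 8 * (leftDeriv F w Complex.I 1 : ℂ) * (leftDeriv F w Complex.I 2 : ℂ)) * hI
  · linear_combination
      (-5 / 8 * (leftDeriv F w Complex.I 0 : ℂ) * (leftDeriv F w Complex.I 2 : ℂ)) * hI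
  · ring

end ConformalOn

end SLTilde

namespace SLTilde

/-! ### Generating spinors and Dirac potentials -/

section Wirtinger

variable {g h : ℂ → ℂ} {w : ℂ}

theorem dzbar_add_const_mul (hg : DifferentiableAt ℝ g w) (hh : DifferentiableAt ℝ h w) (a b : ℂ) :
    dzbar (fun p => a * g p + b * h p) w = a * dzbar g w + b * dzbar h w := by
  have e := ((hg.hasFDerivAt.const_mul a).add (hh.hasFDerivAt.const_mul b)).fderiv
  rw [dzbar]
  refine (congrArg (fun L : ℂ →L[ℝ] ℂ => (L 1 + Complex.I * L Complex.I) / 2) e).trans ?_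
  simp [dzbar]
  ring

theorem dzbar_sq (hg : DifferentiableAt ℝ g w) :
    dzbar (fun p => g p ^ 2) w = 2 * g w * dzbar g w := by
  have e := (hg.hasFDerivAt.mul hg.hasFDerivAt).fderiv
  have : (fun p => g p ^ 2) = fun p => g p * g p := by
    ext p
    ring
  rw [dzbar, this]
  refine (congrArg (fun L : ℂ →L[ℝ] ℂ => (L 1 + Complex.I * L Complex.I) / 2) e).trans ?_
  simp [dzbar]
  ring

theorem dzbar_conj (g : ℂ → ℂ) (w : ℂ) : dzbar (fun p => conj (g p)) w = conj (dz g w) := by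
  have e : fderiv ℝ (fun p => conj (g p)) w = _ := Complex.conjCLE.comp_fderiv (f := g) (x := w)
  rw [dzbar, e, dz]
  simp [map_ofNat]

end Wirtinger

variable {F : ℂ → SLTilde} {D : Set ℂ} {w : ℂ} {ψ₁ ψ₂ U V : ℂ → ℂ}

/-- The density of the energy with respect to the area. -/
noncomputable def energyDensityAt (F : ℂ → SLTilde) (w : ℂ) : ℂ :=
  ((1 / 4 * (meanCurvatureAt F w ^ 2 + 5 / 16 * tangentSectionalAt F w - 1 / 4) : ℝ) : ℂ) -
    Complex.I * ((5 / 8 * (meanCurvatureAt F w * unitNormal F w 2) : ℝ) : ℂ)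

/-- The Dirac potential `U` of a spinor. -/
noncomputable def potentialU (F : ℂ → SLTilde) (ψ₁ ψ₂ : ℂ → ℂ) (w : ℂ) : ℂ :=
  meanCurvatureAt F w / 2 * (ψ₁ w * conj (ψ₁ w) + ψ₂ w * conj (ψ₂ w)) +
    Complex.I * (1 / 2 * (ψ₁ w * conj (ψ₁ w)) - 3 / 4 * (ψ₂ w * conj (ψ₂ w)))

/-- The Dirac potential `V` of a spinor. -/
noncomputable def potentialV (F : ℂ → SLTilde) (ψ₁ ψ₂ : ℂ → ℂ) (w : ℂ) : ℂ :=
  meanCurvatureAt F w / 2 * (ψ₁ w * conj (ψ₁ w) + ψ₂ w * conj (ψ₂ w)) +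
    Complex.I * (3 / 4 * (ψ₁ w * conj (ψ₁ w)) - 1 / 2 * (ψ₂ w * conj (ψ₂ w)))

/-- `X × Y = -2i Z × conj Z`, which makes the normal polynomial in the spinor and its conjugate. -/
theorem areaVector_zCoord (F : ℂ → SLTilde) (w : ℂ) (k : Fin 3) : (areaVector F w k : ℂ) =
    -2 * Complex.I *
      (![zCoord F w 1 * conj (zCoord F w 2) - zCoord F w 2 * conj (zCoord F w 1),
        zCoord F w 2 * conj (zCoord F w 0) - zCoord F w 0 * conj (zCoord F w 2),
        zCoord F w 0 * conj (zCoord F w 1) - zCoord F w 1 * conj (zCoord F w 0)] : Fin 3 → ℂ) k := by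
  have hI := Complex.I_mul_I
  rw [areaVector_eq]
  fin_cases k <;> simp [zCoord, map_ofNat]
  · linear_combination ((leftDeriv F w 1 1 * leftDeriv F w Complex.I 2 : ℂ) -
      leftDeriv F w 1 2 * leftDeriv F w Complex.I 1) * hI
  · linear_combination ((leftDeriv F w 1 2 * leftDeriv F w Complex.I 0 : ℂ) -
      leftDeriv F w 1 0 * leftDeriv F w Complex.I 2) * hI
  · linear_combination ((leftDeriv F w 1 0 * leftDeriv F w Complex.I 1 : ℂ) -
      leftDeriv F w 1 1 * leftDeriv F w Complex.I 0) * hI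

namespace ConformalOn

theorem contDiffOn_zCoord (h : ConformalOn F D) (k : Fin 3) :
    ContDiffOn ℝ ∞ (fun p => zCoord F p k) D := by
  have e (v) : ContDiffOn ℝ ∞ (fun p => (leftDeriv F p v k : ℂ)) D :=
    Complex.ofRealCLM.contDiff.comp_contDiffOn (h.smoothOn.leftDeriv h.isOpen v k)
  exact ((e 1).sub (contDiffOn_const.mul (e Complex.I))).div_const 2

theorem differentiableAt_zCoord (h : ConformalOn F D) (hw : w ∈ D) (k : Fin 3) :
    DifferentiableAt ℝ (fun p => zCoord F p k) w :=
  ((h.contDiffOn_zCoord k).contDiffAt (h.isOpen.mem_nhds hw)).differentiableAt (by simp)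

/-- Real and imaginary parts are the two conformality conditions `|X| = |Y|` and `⟨X, Y⟩ = 0`. -/
theorem sum_zCoord_sq (h : ConformalOn F D) (hw : w ∈ D) :
    zCoord F w 0 ^ 2 + zCoord F w 1 ^ 2 + zCoord F w 2 ^ 2 = 0 := by
  obtain ⟨-, h2, h3⟩ := h.conformal w hw
  have h2' := congrArg (fun t : ℝ => (t : ℂ)) h2
  have h3' := congrArg (fun t : ℝ => (t : ℂ)) h3
  simp [firstForm, dotProduct, Fin.sum_univ_three] at h2' h3'
  have hI := Complex.I_mul_I
  simp only [zCoord]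
  linear_combination h2' / 4 - Complex.I / 2 * h3' + ((leftDeriv F w Complex.I 0 : ℂ) ^ 2 +
    (leftDeriv F w Complex.I 1 : ℂ) ^ 2 + (leftDeriv F w Complex.I 2 : ℂ) ^ 2) / 4 * hI

theorem firstForm_zCoord (h : ConformalOn F D) (hw : w ∈ D) : (firstForm F w 1 1 : ℂ) =
    2 * (zCoord F w 0 * conj (zCoord F w 0) + zCoord F w 1 * conj (zCoord F w 1) +
      zCoord F w 2 * conj (zCoord F w 2)) := by
  obtain ⟨-, h2, -⟩ := h.conformal w hw
  have h2' := congrArg (fun t : ℝ => (t : ℂ)) h2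
  simp [firstForm, dotProduct, Fin.sum_univ_three] at h2'
  have hI := Complex.I_mul_I
  simp [zCoord, firstForm, dotProduct, Fin.sum_univ_three, map_ofNat]
  linear_combination h2' / 2 + ((leftDeriv F w Complex.I 0 : ℂ) ^ 2 +
    (leftDeriv F w Complex.I 1 : ℂ) ^ 2 + (leftDeriv F w Complex.I 2 : ℂ) ^ 2) / 2 * hI

theorem firstForm_spinor (h : ConformalOn F D) (hψ : IsGeneratingSpinor F D ψ₁ ψ₂) (hw : w ∈ D) :
    firstForm F w 1 1 = (Complex.normSq (ψ₁ w) + Complex.normSq (ψ₂ w)) ^ 2 := by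
  obtain ⟨z0, z1, z2⟩ := hψ.2.2 w hw
  have e := h.firstForm_zCoord hw
  rw [z0, z1, z2] at e
  simp [map_ofNat] at e
  have hI := Complex.I_mul_I
  have : ((firstForm F w 1 1 : ℝ) : ℂ) =
      (((Complex.normSq (ψ₁ w) + Complex.normSq (ψ₂ w)) ^ 2 : ℝ) : ℂ) := by
    push_cast
    rw [e, ← Complex.mul_conj, ← Complex.mul_conj]
    linear_combination (-(conj (ψ₂ w) ^ 2 + ψ₁ w ^ 2) * (ψ₂ w ^ 2 + conj (ψ₁ w) ^ 2) / 2) * hI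
  exact_mod_cast this

theorem areaVector_spinor (hψ : IsGeneratingSpinor F D ψ₁ ψ₂) (hw : w ∈ D) :
    areaVector F w 2 = Complex.normSq (ψ₂ w) ^ 2 - Complex.normSq (ψ₁ w) ^ 2 := by
  obtain ⟨z0, z1, z2⟩ := hψ.2.2 w hw
  have e := areaVector_zCoord F w 2
  simp [z0, z1, map_ofNat] at e
  have hI := Complex.I_mul_I
  have : ((areaVector F w 2 : ℝ) : ℂ) =
      ((Complex.normSq (ψ₂ w) ^ 2 - Complex.normSq (ψ₁ w) ^ 2 : ℝ) : ℂ) := by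
    push_cast
    rw [e, ← Complex.mul_conj, ← Complex.mul_conj]
    linear_combination (-((ψ₂ w * conj (ψ₂ w)) ^ 2 - (ψ₁ w * conj (ψ₁ w)) ^ 2)) * hI
  exact_mod_cast this

theorem unitNormal_spinor (h : ConformalOn F D) (hψ : IsGeneratingSpinor F D ψ₁ ψ₂) (hw : w ∈ D) :
    0 < Complex.normSq (ψ₁ w) + Complex.normSq (ψ₂ w) ∧
    unitNormal F w 2 = (Complex.normSq (ψ₂ w) - Complex.normSq (ψ₁ w)) /
      (Complex.normSq (ψ₁ w) + Complex.normSq (ψ₂ w)) := by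
  have h1 := (h.conformal w hw).1
  rw [h.firstForm_spinor hψ hw] at h1
  have h2 : 0 < Complex.normSq (ψ₁ w) + Complex.normSq (ψ₂ w) := by
    have := Complex.normSq_nonneg (ψ₁ w)
    have := Complex.normSq_nonneg (ψ₂ w)
    exact (by positivity : (0 : ℝ) ≤ _).lt_of_ne' (by
      intro h0
      rw [h0] at h1
      norm_num at h1)
  refine ⟨h2, ?_⟩
  rw [h.unitNormal_eq hw, h.firstForm_spinor hψ hw]
  simp only [Pi.smul_apply, smul_eq_mul, areaVector_spinor hψ hw]
  field_simp
  ring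

/-- With `p = |ψ₁|²` and `q = |ψ₂|²` one has `λ = (p + q)²` and `N₃ = (q - p)/(p + q)`. The products
of the imaginary parts reproduce `1/64 - (25/64) N₃² = 5/64 K̂ - 1/16`, and the mixed terms give the
imaginary part with `H N₃`. -/
theorem potentialU_mul_potentialV (h : ConformalOn F D) (hψ : IsGeneratingSpinor F D ψ₁ ψ₂)
    (hw : w ∈ D) : potentialU F ψ₁ ψ₂ w * potentialV F ψ₁ ψ₂ w =
      firstForm F w 1 1 * energyDensityAt F w := by
  obtain ⟨hs, hn⟩ := h.unitNormal_spinor hψ hw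
  rw [energyDensityAt, h.tangentSectionalAt_eq hw, hn, h.firstForm_spinor hψ hw, potentialU,
    potentialV]
  simp only [Complex.mul_conj]
  set p := Complex.normSq (ψ₁ w)
  set q := Complex.normSq (ψ₂ w)
  have hs' : (p + q : ℂ) ≠ 0 := by exact_mod_cast hs.ne'
  push_cast
  field_simp
  linear_combination (3072 * (p ^ 2 + q ^ 2 : ℂ) - 6656 * (p * q)) * Complex.I_sq

/-- The structure equation is linear in `Z`, hence controls only the squares `ψ₁² = -iZ₁ - Z₂` and
`conj ψ₂² = -iZ₁ + Z₂`. Their derivatives carry the factors `ψ₁` and `ψ₂`, which cannot be cancelled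
at zeros of the spinor components. -/
theorem spinor_eq (h : ConformalOn F D) (hψ : IsGeneratingSpinor F D ψ₁ ψ₂) (hw : w ∈ D) :
    ψ₁ w * (-dzbar ψ₁ w + potentialV F ψ₁ ψ₂ w * ψ₂ w) = 0 ∧
    ψ₂ w * (dz ψ₂ w + potentialU F ψ₁ ψ₂ w * ψ₁ w) = 0 := by
  have hev := h.isOpen.mem_nhds hw
  have d1 := (hψ.1.contDiffAt hev).differentiableAt (by simp)
  have d2 := (hψ.2.1.contDiffAt hev).differentiableAt (by simp)
  have d2' : DifferentiableAt ℝ (fun p => conj (ψ₂ p)) w :=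
    Complex.conjCLE.differentiableAt.comp w d2
  have e1 : dzbar (fun p => ψ₁ p ^ 2) w =
      dzbar (fun p => -Complex.I * zCoord F p 0 + -1 * zCoord F p 1) w := by
    rw [dzbar, dzbar, Filter.EventuallyEq.fderiv_eq]
    filter_upwards [hev] with p hp
    obtain ⟨z0, z1, -⟩ := hψ.2.2 p hp
    rw [z0, z1]
    linear_combination (conj (ψ₂ p) ^ 2 + ψ₁ p ^ 2) / 2 * Complex.I_mul_I
  have e2 : dzbar (fun p => conj (ψ₂ p) ^ 2) w =
      dzbar (fun p => -Complex.I * zCoord F p 0 + 1 * zCoord F p 1) w := by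
    rw [dzbar, dzbar, Filter.EventuallyEq.fderiv_eq]
    filter_upwards [hev] with p hp
    obtain ⟨z0, z1, -⟩ := hψ.2.2 p hp
    rw [z0, z1]
    linear_combination (conj (ψ₂ p) ^ 2 + ψ₁ p ^ 2) / 2 * Complex.I_mul_I
  rw [dzbar_sq d1, dzbar_add_const_mul (h.differentiableAt_zCoord hw _)
    (h.differentiableAt_zCoord hw _), h.structure_eq hw, h.structure_eq hw, areaVector_zCoord,
    areaVector_zCoord] at e1
  rw [dzbar_sq d2', dzbar_add_const_mul (h.differentiableAt_zCoord hw _)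
    (h.differentiableAt_zCoord hw _), h.structure_eq hw, h.structure_eq hw, areaVector_zCoord,
    areaVector_zCoord, dzbar_conj] at e2
  obtain ⟨z0, z1, z2⟩ := hψ.2.2 w hw
  simp only [z0, z1, z2, Matrix.cons_val] at e1 e2
  -- Conjugation turns `∂̄(conj ψ₂)` into `∂ψ₂`.
  have e2' := congrArg conj e2
  simp [map_ofNat] at e1 e2'
  simp only [potentialU, potentialV]
  have hI := Complex.I_sq
  constructor
  · linear_combination (norm := skip) -e1 / 2
    ring_nf
    simp only [Complex.I_sq, Complex.I_pow_three]
    ring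
  · linear_combination (norm := skip) e2' / 2
    ring_nf
    simp only [Complex.I_sq, Complex.I_pow_three]
    ring

end ConformalOn
end SLTilde

/-! ### Density of nonzero spinors, the potentials and their product, local existence of spinors -/

namespace SLTilde

variable {F : ℂ → SLTilde} {D : Set ℂ} {w : ℂ} {ψ₁ ψ₂ U V : ℂ → ℂ}

namespace ConformalOn

theorem mono (h : ConformalOn F D) {D' : Set ℂ} (hD' : IsOpen D') (hs : D' ⊆ D) :
    ConformalOn F D' :=
  ⟨hD', ContDiffOn.mono h.smoothOn hs, fun w hw => h.conformal w (hs hw)⟩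

theorem continuousOn_leftDeriv (h : ConformalOn F D) (v : ℂ) (k : Fin 3) :
    ContinuousOn (fun w => leftDeriv F w v k) D :=
  (h.smoothOn.leftDeriv h.isOpen v k).continuousOn

theorem continuousOn_derivLeft (h : ConformalOn F D) (u v : ℂ) (k : Fin 3) :
    ContinuousOn (fun w => derivLeft F w u v k) D :=
  (((h.smoothOn.leftDeriv h.isOpen v k).fderiv_of_isOpen (m := ∞) h.isOpen
    (by simp)).clm_apply contDiffOn_const).continuousOn

theorem continuousOn_firstForm (h : ConformalOn F D) (a b : ℂ) :
    ContinuousOn (fun w => firstForm F w a b) D := by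
  simp only [firstForm, dotProduct]
  exact continuousOn_finsetSum _ fun k _ =>
    (h.continuousOn_leftDeriv a k).mul (h.continuousOn_leftDeriv b k)

theorem continuousOn_areaVector (h : ConformalOn F D) (k : Fin 3) :
    ContinuousOn (fun w => areaVector F w k) D := by
  have e := h.continuousOn_leftDeriv
  simp only [areaVector_eq]
  fin_cases k
  · exact ((e 1 1).mul (e Complex.I 2)).sub ((e 1 2).mul (e Complex.I 1))
  · exact ((e 1 2).mul (e Complex.I 0)).sub ((e 1 0).mul (e Complex.I 2))
  · exact ((e 1 0).mul (e Complex.I 1)).sub ((e 1 1).mul (e Complex.I 0))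

theorem continuousOn_covDeriv (h : ConformalOn F D) (u v : ℂ) (k : Fin 3) :
    ContinuousOn (fun w => covDeriv F w u v k) D := by
  have e := h.continuousOn_leftDeriv
  have e' : ContinuousOn (fun w => nabla (leftDeriv F w u) (leftDeriv F w v) k) D := by
    simp only [nabla]
    exact continuousOn_finsetSum _ fun i _ => continuousOn_finsetSum _ fun j _ =>
      ((e u i).mul (e v j)).mul continuousOn_const
  exact (h.continuousOn_derivLeft u v k).add e'

theorem continuousOn_meanCurvatureAt (h : ConformalOn F D) :
    ContinuousOn (meanCurvatureAt F) D := by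
  refine ContinuousOn.congr ?_ fun w hw => h.meanCurvatureAt_eq hw
  refine ContinuousOn.div ?_ (continuousOn_const.mul ((h.continuousOn_firstForm 1 1).pow 2)) ?_
  · simp only [dotProduct]
    exact continuousOn_finsetSum _ fun k _ => ((h.continuousOn_covDeriv 1 1 k).add
      (h.continuousOn_covDeriv Complex.I Complex.I k)).mul (h.continuousOn_areaVector k)
  · intro w hw
    have := (h.conformal w hw).1
    positivity

theorem continuousOn_unitNormal (h : ConformalOn F D) (k : Fin 3) :
    ContinuousOn (fun w => unitNormal F w k) D := by
  refine ContinuousOn.congr (f := fun w => (firstForm F w 1 1)⁻¹ * areaVector F w k) ?_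
    fun w hw => by
      simp only [h.unitNormal_eq hw]
      rfl
  exact ((h.continuousOn_firstForm 1 1).inv₀ fun w hw => (h.conformal w hw).1.ne').mul
    (h.continuousOn_areaVector k)

theorem continuousOn_tangentSectionalAt (h : ConformalOn F D) :
    ContinuousOn (tangentSectionalAt F) D :=
  ContinuousOn.congr (f := fun w => 1 - 5 * unitNormal F w 2 ^ 2)
    (continuousOn_const.sub (continuousOn_const.mul ((h.continuousOn_unitNormal 2).pow 2)))
    fun _ hw => h.tangentSectionalAt_eq hw

theorem continuousOn_energyDensityAt (h : ConformalOn F D) :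
    ContinuousOn (energyDensityAt F) D := by
  have h1 := h.continuousOn_meanCurvatureAt
  have h2 := h.continuousOn_tangentSectionalAt
  have h3 := h.continuousOn_unitNormal 2
  refine ContinuousOn.sub ?_ (continuousOn_const.mul ?_)
  · exact Complex.continuous_ofReal.comp_continuousOn (continuousOn_const.mul
      (((h1.pow 2).add (continuousOn_const.mul h2)).sub continuousOn_const))
  · exact Complex.continuous_ofReal.comp_continuousOn (continuousOn_const.mul (h1.mul h3))

theorem continuousOn_potentials (h : ConformalOn F D) (hψ : IsGeneratingSpinor F D ψ₁ ψ₂) :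
    ContinuousOn (potentialU F ψ₁ ψ₂) D ∧ ContinuousOn (potentialV F ψ₁ ψ₂) D := by
  have h1 : ContinuousOn (fun w => (meanCurvatureAt F w : ℂ) / 2) D :=
    (Complex.continuous_ofReal.comp_continuousOn h.continuousOn_meanCurvatureAt).div_const 2
  have c1 := hψ.1.continuousOn
  have c2 := hψ.2.1.continuousOn
  have h2 := c1.mul (Complex.continuous_conj.comp_continuousOn c1)
  have h3 := c2.mul (Complex.continuous_conj.comp_continuousOn c2)
  exact ⟨(h1.mul (h2.add h3)).add (continuousOn_const.mul
      ((continuousOn_const.mul h2).sub (continuousOn_const.mul h3))),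
    (h1.mul (h2.add h3)).add (continuousOn_const.mul
      ((continuousOn_const.mul h2).sub (continuousOn_const.mul h3)))⟩

/-- The spinor components do not vanish on open sets: the planes spanned by `e₁, e₂` form a contact
distribution, so that no piece of a surface is tangent to it. -/
theorem subset_closure_spinor_ne_zero (h : ConformalOn F D)
    (hψ : IsGeneratingSpinor F D ψ₁ ψ₂) : D ⊆ closure {p ∈ D | ψ₁ p ≠ 0 ∧ ψ₂ p ≠ 0} := by
  intro w hw
  by_contra hcl
  have hev : ∀ᶠ p in nhds w, p ∈ D ∧ p ∉ {p ∈ D | ψ₁ p ≠ 0 ∧ ψ₂ p ≠ 0} := by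
    filter_upwards [h.isOpen.mem_nhds hw, isClosed_closure.isOpen_compl.mem_nhds hcl] with p h1 h2
      using ⟨h1, fun hp => h2 (subset_closure hp)⟩
  have hz : (fun p => zCoord F p 2) =ᶠ[nhds w] fun _ => 0 := by
    filter_upwards [hev] with p hp
    rw [(hψ.2.2 p hp.1).2.2]
    by_cases h1 : ψ₁ p = 0
    · simp [h1]
    · have h2 : ψ₂ p = 0 := by
        by_contra h2
        exact hp.2 ⟨hp.1, h1, h2⟩
      simp [h2]
  have hd : dzbar (fun p => zCoord F p 2) w = 0 := by
    rw [dzbar, hz.fderiv_eq]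
    simp
  rw [h.structure_eq hw] at hd
  -- The third structure equation reads `∂̄Z₃ = (H - i)/2 · (X × Y)₃`, and `H - i ≠ 0` because `H`
  -- is real. Then `|ψ₁| = |ψ₂|`, which with `ψ₁ conj ψ₂ = 0` contradicts `λ > 0`.
  have ha : areaVector F w 2 = 0 := by
    have hne : ((meanCurvatureAt F w : ℂ) - Complex.I) / 2 ≠ 0 := by
      intro h0
      have := congrArg Complex.im h0
      simp at this
    simp at hd
    rcases hd with hd | hd
    · exact absurd (by rw [hd, zero_div]) hne
    · exact hd
  obtain ⟨hs, hn⟩ := h.unitNormal_spinor hψ hw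
  rw [areaVector_spinor hψ hw] at ha
  have hmul : Complex.normSq (ψ₁ w) * Complex.normSq (ψ₂ w) = 0 := by
    have h0 := hz.eq_of_nhds
    rw [(hψ.2.2 w hw).2.2] at h0
    have := congrArg Complex.normSq h0
    simpa [Complex.normSq_mul] using this
  have : (Complex.normSq (ψ₂ w) - Complex.normSq (ψ₁ w)) = 0 := by
    have h3 : (Complex.normSq (ψ₂ w) - Complex.normSq (ψ₁ w)) *
      (Complex.normSq (ψ₁ w) + Complex.normSq (ψ₂ w)) = 0 := by linear_combination ha
    exact (mul_eq_zero.1 h3).resolve_right hs.ne'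
  nlinarith

theorem eqOn_of_eqOn_spinor_ne_zero (h : ConformalOn F D) (hψ : IsGeneratingSpinor F D ψ₁ ψ₂)
    {a b : ℂ → ℂ} (ha : ContinuousOn a D) (hb : ContinuousOn b D)
    (hab : ∀ w ∈ D, ψ₁ w ≠ 0 → ψ₂ w ≠ 0 → a w = b w) : Set.EqOn a b D :=
  Set.EqOn.of_subset_closure (s := {p ∈ D | ψ₁ p ≠ 0 ∧ ψ₂ p ≠ 0})
    (fun w hw => hab w hw.1 hw.2.1 hw.2.2) ha hb (Set.sep_subset _ _)
    (h.subset_closure_spinor_ne_zero hψ)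

/-- Both Dirac equations hold where neither component vanishes; all terms are continuous and this
set is dense. -/
theorem isDiracPotential (h : ConformalOn F D) (hψ : IsGeneratingSpinor F D ψ₁ ψ₂) :
    IsDiracPotential D ψ₁ ψ₂ (potentialU F ψ₁ ψ₂) (potentialV F ψ₁ ψ₂) := by
  obtain ⟨hU, hV⟩ := h.continuousOn_potentials hψ
  have hfd {g : ℂ → ℂ} (hg : ContDiffOn ℝ ∞ g D) (v : ℂ) :
      ContinuousOn (fun w => fderiv ℝ g w v) D :=
    ((hg.fderiv_of_isOpen (m := ∞) h.isOpen (by simp)).clm_apply contDiffOn_const).continuousOn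
  have c1 : ContinuousOn (dzbar ψ₁) D :=
    ((hfd hψ.1 1).add (continuousOn_const.mul (hfd hψ.1 Complex.I))).div_const 2
  have c2 : ContinuousOn (dz ψ₂) D :=
    ((hfd hψ.2.1 1).sub (continuousOn_const.mul (hfd hψ.2.1 Complex.I))).div_const 2
  have e1 := h.eqOn_of_eqOn_spinor_ne_zero hψ (c2.add (hU.mul hψ.1.continuousOn))
    (continuousOn_const (c := 0))
    fun w hw _ h2 => (mul_eq_zero.1 (h.spinor_eq hψ hw).2).resolve_left h2
  have e2 := h.eqOn_of_eqOn_spinor_ne_zero hψ (c1.neg.add (hV.mul hψ.2.1.continuousOn))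
    (continuousOn_const (c := 0))
    fun w hw h1 _ => (mul_eq_zero.1 (h.spinor_eq hψ hw).1).resolve_left h1
  exact ⟨hU, hV, fun w hw => ⟨e1 hw, e2 hw⟩⟩

/-- The local expression of the energy does not depend on the spinor and its potentials. -/
theorem potential_mul (h : ConformalOn F D) (hψ : IsGeneratingSpinor F D ψ₁ ψ₂)
    (hUV : IsDiracPotential D ψ₁ ψ₂ U V) (hw : w ∈ D) :
    U w * V w = firstForm F w 1 1 * energyDensityAt F w := by
  obtain ⟨hU, hV⟩ := h.continuousOn_potentials hψ
  rw [← h.potentialU_mul_potentialV hψ hw]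
  refine h.eqOn_of_eqOn_spinor_ne_zero hψ (hUV.1.mul hUV.2.1) (hU.mul hV) ?_ hw
  intro p hp h1 h2
  obtain ⟨a1, a2⟩ := hUV.2.2 p hp
  obtain ⟨b1, b2⟩ := (h.isDiracPotential hψ).2.2 p hp
  -- At a point where neither component vanishes the Dirac equations can be solved for `U` and `V`.
  have e1 : U p = potentialU F ψ₁ ψ₂ p := mul_right_cancel₀ h1 (by linear_combination a1 - b1)
  have e2 : V p = potentialV F ψ₁ ψ₂ p := mul_right_cancel₀ h2 (by linear_combination a2 - b2)
  simp only [Pi.mul_apply, e1, e2]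

end ConformalOn

/-- Dividing by `A w` moves the value at `w` to `1`, where the principal logarithm is smooth; `c` is
any square root of `A w`. -/
theorem exists_contDiffOn_sqrt {A : ℂ → ℂ} (hD : IsOpen D) (hA : ContDiffOn ℝ ∞ A D) (hw : w ∈ D)
    (h0 : A w ≠ 0) : ∃ D' ⊆ D, IsOpen D' ∧ w ∈ D' ∧ ∃ χ : ℂ → ℂ, ContDiffOn ℝ ∞ χ D' ∧
      ∀ p ∈ D', χ p ≠ 0 ∧ χ p ^ 2 = A p := by
  obtain ⟨c, hc⟩ := IsAlgClosed.exists_pow_nat_eq (A w) two_pos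
  have hq : ContDiffOn ℝ ∞ (fun p => A p / A w) D := hA.div_const _
  refine ⟨D ∩ (fun p => A p / A w) ⁻¹' Complex.slitPlane, Set.inter_subset_left,
    hq.continuousOn.isOpen_inter_preimage hD Complex.isOpen_slitPlane, ⟨hw, ?_⟩,
    fun p => c * Complex.exp (Complex.log (A p / A w) / 2), ?_, ?_⟩
  · simp [div_self h0]
  · refine contDiffOn_const.mul (ContDiffOn.cexp (ContDiffOn.div_const ?_ 2))
    intro p hp
    have h1 : ContDiffAt ℝ ∞ Complex.log (A p / A w) :=
      (Complex.contDiffAt_log (n := ∞) hp.2).restrict_scalars ℝ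
    exact h1.comp_contDiffWithinAt p ((hq.mono Set.inter_subset_left) p hp)
  · rintro p ⟨-, hp⟩
    have hc0 : c ≠ 0 := by
      rintro rfl
      exact h0 (by simpa using hc.symm)
    refine ⟨mul_ne_zero hc0 (Complex.exp_ne_zero _), ?_⟩
    have hp0 : A p / A w ≠ 0 := Complex.slitPlane_ne_zero hp
    rw [mul_pow, ← Complex.exp_nat_mul, hc, Nat.cast_two, mul_div_cancel₀ _ two_ne_zero,
      Complex.exp_log hp0, mul_div_cancel₀ _ h0]

/-- `A` and `B` are the prescribed values of `ψ₁²` and `conj ψ₂²`, and `A B = Z₃²`. They cannot both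
vanish at `w`, for then `Z = 0`. A square root of the nonvanishing one is chosen, and the other
component is `Z₃` divided by it; this fixes the relative sign. -/
theorem ConformalOn.exists_spinor (h : ConformalOn F D) (hw : w ∈ D) :
    ∃ D' ⊆ D, IsOpen D' ∧ w ∈ D' ∧ ∃ ψ₁ ψ₂ : ℂ → ℂ, IsGeneratingSpinor F D' ψ₁ ψ₂ := by
  set A : ℂ → ℂ := fun p => -Complex.I * zCoord F p 0 - zCoord F p 1 with hA
  set B : ℂ → ℂ := fun p => -Complex.I * zCoord F p 0 + zCoord F p 1 with hB
  have cA : ContDiffOn ℝ ∞ A D :=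
    (contDiffOn_const.mul (h.contDiffOn_zCoord 0)).sub (h.contDiffOn_zCoord 1)
  have cB : ContDiffOn ℝ ∞ B D :=
    (contDiffOn_const.mul (h.contDiffOn_zCoord 0)).add (h.contDiffOn_zCoord 1)
  have cC := h.contDiffOn_zCoord 2
  have hAB {p} (hp : p ∈ D) : A p * B p = zCoord F p 2 ^ 2 := by
    have := h.sum_zCoord_sq hp
    linear_combination zCoord F p 0 ^ 2 * Complex.I_sq - this
  suffices H : ∃ D' ⊆ D, IsOpen D' ∧ w ∈ D' ∧ ∃ χ₁ χ₂ : ℂ → ℂ, ContDiffOn ℝ ∞ χ₁ D' ∧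
      ContDiffOn ℝ ∞ χ₂ D' ∧ ∀ p ∈ D', χ₁ p ^ 2 = A p ∧ χ₂ p ^ 2 = B p ∧
        χ₁ p * χ₂ p = zCoord F p 2 by
    obtain ⟨D', hs, ho, hw', χ₁, χ₂, h1, h2, h3⟩ := H
    refine ⟨D', hs, ho, hw', χ₁, fun p => conj (χ₂ p), h1,
      Complex.conjCLE.contDiff.comp_contDiffOn h2, fun p hp => ?_⟩
    obtain ⟨e1, e2, e3⟩ := h3 p hp
    simp only [Complex.conj_conj, e1, e2, e3, hA, hB]
    refine ⟨?_, ?_, trivial⟩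
    · linear_combination zCoord F p 0 * Complex.I_sq
    · ring
  by_cases h0 : A w = 0
  · have h1 : B w ≠ 0 := by
      intro h1
      have z2 : zCoord F w 2 = 0 := by
        have := hAB hw
        rw [h0, zero_mul] at this
        exact pow_eq_zero_iff (two_ne_zero) |>.1 this.symm
      simp only [hA, hB] at h0 h1
      have z1 : zCoord F w 1 = 0 := by linear_combination (h1 - h0) / 2
      have z0 : zCoord F w 0 = 0 := by
        have : Complex.I * zCoord F w 0 = 0 := by linear_combination -(h1 + h0) / 2
        exact (mul_eq_zero.1 this).resolve_left Complex.I_ne_zero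
      have e := h.firstForm_zCoord hw
      rw [z0, z1, z2] at e
      simp at e
      exact (h.conformal w hw).1.ne' e
    obtain ⟨D', hs, ho, hw', χ, hχ, hχ'⟩ := exists_contDiffOn_sqrt h.isOpen cB hw h1
    refine ⟨D', hs, ho, hw', fun p => zCoord F p 2 / χ p, χ,
      by
        simp only [div_eq_mul_inv]
        exact (cC.mono hs).mul (hχ.inv fun p hp => (hχ' p hp).1), hχ, fun p hp => ?_⟩
    obtain ⟨e1, e2⟩ := hχ' p hp
    refine ⟨?_, e2, div_mul_cancel₀ _ e1⟩
    rw [div_pow, e2, ← hAB (hs hp), mul_div_cancel_right₀]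
    rw [← e2]
    exact pow_ne_zero 2 e1
  · obtain ⟨D', hs, ho, hw', χ, hχ, hχ'⟩ := exists_contDiffOn_sqrt h.isOpen cA hw h0
    refine ⟨D', hs, ho, hw', χ, fun p => zCoord F p 2 / χ p, hχ,
      by
        simp only [div_eq_mul_inv]
        exact (cC.mono hs).mul (hχ.inv fun p hp => (hχ' p hp).1), fun p hp => ?_⟩
    obtain ⟨e1, e2⟩ := hχ' p hp
    refine ⟨e2, ?_, mul_div_cancel₀ _ e1⟩
    rw [div_pow, e2, ← hAB (hs hp), mul_div_cancel_left₀]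
    rw [← e2]
    exact pow_ne_zero 2 e1

end SLTilde

namespace SLTilde

/-! ### Change of the conformal parameter -/

theorem clm_apply_eq {E : Type*} [NormedAddCommGroup E] [NormedSpace ℝ E] (L : ℂ →L[ℝ] E) (c : ℂ) :
    L c = c.re • L 1 + c.im • L Complex.I := by
  rw [← map_smul, ← map_smul, ← map_add]
  congr 1
  apply Complex.ext <;> simp

theorem fderiv_real_apply {φ : ℂ → ℂ} {w : ℂ} (hφ : DifferentiableAt ℂ φ w) (v : ℂ) :
    fderiv ℝ φ w v = deriv φ w * v := by
  rw [(hφ.hasDerivAt.hasFDerivAt.restrictScalars ℝ).fderiv]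
  simp [mul_comm]

theorem dzbar_eq_zero {φ : ℂ → ℂ} {w : ℂ} (hφ : DifferentiableAt ℂ φ w) : dzbar φ w = 0 := by
  rw [dzbar, fderiv_real_apply hφ, fderiv_real_apply hφ]
  linear_combination deriv φ w / 2 * Complex.I_sq

theorem fderiv_comp_apply {E : Type*} [NormedAddCommGroup E] [NormedSpace ℝ E] {g : ℂ → E}
    {φ : ℂ → ℂ} {w : ℂ} (hg : DifferentiableAt ℝ g (φ w)) (hφ : DifferentiableAt ℂ φ w) (v : ℂ) :
    fderiv ℝ (fun p => g (φ p)) w v = fderiv ℝ g (φ w) (deriv φ w * v) := by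
  have := fderiv_comp w hg (hφ.restrictScalars ℝ)
  rw [Function.comp_def] at this
  rw [this, ContinuousLinearMap.comp_apply, fderiv_real_apply hφ]

theorem dzbar_comp {g φ : ℂ → ℂ} {w : ℂ} (hg : DifferentiableAt ℝ g (φ w))
    (hφ : DifferentiableAt ℂ φ w) :
    dzbar (fun p => g (φ p)) w = conj (deriv φ w) * dzbar g (φ w) := by
  rw [dzbar, fderiv_comp_apply hg hφ, fderiv_comp_apply hg hφ, clm_apply_eq _ (deriv φ w * 1),
    clm_apply_eq _ (deriv φ w * Complex.I), dzbar]
  have hc : conj (deriv φ w) = (deriv φ w).re - (deriv φ w).im * Complex.I := by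
    apply Complex.ext <;> simp
  rw [hc]
  simp
  linear_combination (deriv φ w).im * fderiv ℝ g (φ w) Complex.I / 2 * Complex.I_sq

theorem dzbar_mul {g h : ℂ → ℂ} {w : ℂ} (hg : DifferentiableAt ℝ g w)
    (hh : DifferentiableAt ℝ h w) :
    dzbar (fun p => g p * h p) w = g w * dzbar h w + dzbar g w * h w := by
  have e := (hg.hasFDerivAt.mul hh.hasFDerivAt).fderiv
  rw [dzbar]
  refine (congrArg (fun L : ℂ →L[ℝ] ℂ => (L 1 + Complex.I * L Complex.I) / 2) e).trans ?_
  simp [dzbar]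
  ring

theorem leftDeriv_eq_smul_add (F : ℂ → SLTilde) (w v : ℂ) :
    leftDeriv F w v = v.re • leftDeriv F w 1 + v.im • leftDeriv F w Complex.I := by
  simp only [leftDeriv_eq, leftMat]
  have : (Matrix.of fun i j => fderiv ℝ (fun p => (F p).mat i j) w v) =
      v.re • (Matrix.of fun i j => fderiv ℝ (fun p => (F p).mat i j) w 1) +
      v.im • (Matrix.of fun i j => fderiv ℝ (fun p => (F p).mat i j) w Complex.I) := by
    ext i j
    exact clm_apply_eq _ v
  rw [this, Matrix.mul_add, Matrix.mul_smul, Matrix.mul_smul]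
  ext k
  fin_cases k <;> simp [coord] <;> ring

/-- `w ↦ G (φ w)` is a holomorphic change of the parameter which takes `F` on `D` to `G` on `D'`. -/
structure ParamChange (F : ℂ → SLTilde) (D : Set ℂ) (G : ℂ → SLTilde) (D' : Set ℂ)
    (φ : ℂ → ℂ) : Prop where
  left : ConformalOn F D
  right : ConformalOn G D'
  differentiableOn : DifferentiableOn ℂ φ D
  mapsTo : Set.MapsTo φ D D'
  eq : ∀ w ∈ D, F w = G (φ w)

/-- The pairing of `dr` with the component along `e₃` of the left translated derivative. -/
noncomputable def gradPairing (F : ℂ → SLTilde) (r : ℂ → ℝ) (w : ℂ) : ℝ :=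
  (fderiv ℝ r w 1 * leftDeriv F w 1 2 + fderiv ℝ r w Complex.I * leftDeriv F w Complex.I 2) /
    firstForm F w 1 1

namespace ParamChange

variable {F G : ℂ → SLTilde} {D D' : Set ℂ} {φ : ℂ → ℂ} {w : ℂ}

theorem differentiableAt (h : ParamChange F D G D' φ) (hw : w ∈ D) : DifferentiableAt ℂ φ w :=
  h.differentiableOn.differentiableAt (h.left.isOpen.mem_nhds hw)

theorem leftDeriv_eq (h : ParamChange F D G D' φ) (hw : w ∈ D) (v : ℂ) :
    leftDeriv F w v = leftDeriv G (φ w) (deriv φ w * v) := by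
  have e (i j) : fderiv ℝ (fun p => (F p).mat i j) w v =
      fderiv ℝ (fun p => (G p).mat i j) (φ w) (deriv φ w * v) := by
    have hd : DifferentiableAt ℝ (fun p => (G p).mat i j) (φ w) :=
      ((h.right.smoothOn.mat i j).contDiffAt
        (h.right.isOpen.mem_nhds (h.mapsTo hw))).differentiableAt (by simp)
    rw [← fderiv_comp_apply hd (h.differentiableAt hw), Filter.EventuallyEq.fderiv_eq]
    filter_upwards [h.left.isOpen.mem_nhds hw] with p hp
    rw [h.eq p hp]
  simp only [leftDeriv, e, h.eq w hw]

theorem zCoord_eq (h : ParamChange F D G D' φ) (hw : w ∈ D) (k : Fin 3) :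
    zCoord F w k = deriv φ w * zCoord G (φ w) k := by
  have hc : deriv φ w = (deriv φ w).re + (deriv φ w).im * Complex.I := (Complex.re_add_im _).symm
  simp only [zCoord]
  rw [h.leftDeriv_eq hw, h.leftDeriv_eq hw, leftDeriv_eq_smul_add G _ (deriv φ w * 1),
    leftDeriv_eq_smul_add G _ (deriv φ w * Complex.I)]
  simp
  linear_combination -((leftDeriv G (φ w) 1 k : ℂ) -
    Complex.I * (leftDeriv G (φ w) Complex.I k : ℂ)) / 2 * hc +
    (deriv φ w).im * (leftDeriv G (φ w) Complex.I k) / 2 * Complex.I_sq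

theorem firstForm_eq (h : ParamChange F D G D' φ) (hw : w ∈ D) :
    firstForm F w 1 1 = Complex.normSq (deriv φ w) * firstForm G (φ w) 1 1 := by
  have : ((firstForm F w 1 1 : ℝ) : ℂ) =
      ((Complex.normSq (deriv φ w) * firstForm G (φ w) 1 1 : ℝ) : ℂ) := by
    push_cast
    rw [h.left.firstForm_zCoord hw, h.right.firstForm_zCoord (h.mapsTo hw), h.zCoord_eq hw,
      h.zCoord_eq hw, h.zCoord_eq hw, ← Complex.mul_conj]
    simp only [map_mul]
    ring
  exact_mod_cast this

theorem areaVector_eq (h : ParamChange F D G D' φ) (hw : w ∈ D) (k : Fin 3) :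
    areaVector F w k = Complex.normSq (deriv φ w) * areaVector G (φ w) k := by
  have : ((areaVector F w k : ℝ) : ℂ) =
      ((Complex.normSq (deriv φ w) * areaVector G (φ w) k : ℝ) : ℂ) := by
    push_cast
    rw [areaVector_zCoord, areaVector_zCoord, h.zCoord_eq hw,
      h.zCoord_eq hw, h.zCoord_eq hw, ← Complex.mul_conj]
    fin_cases k <;> simp <;> ring
  exact_mod_cast this

theorem normSq_deriv_pos (h : ParamChange F D G D' φ) (hw : w ∈ D) :
    0 < Complex.normSq (deriv φ w) := by
  have h1 := (h.left.conformal w hw).1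
  rw [h.firstForm_eq hw] at h1
  exact pos_of_mul_pos_left h1 (h.right.conformal _ (h.mapsTo hw)).1.le

theorem unitNormal_eq (h : ParamChange F D G D' φ) (hw : w ∈ D) :
    unitNormal F w = unitNormal G (φ w) := by
  rw [h.left.unitNormal_eq hw, h.right.unitNormal_eq (h.mapsTo hw), h.firstForm_eq hw]
  ext k
  have := h.normSq_deriv_pos hw
  have := (h.right.conformal _ (h.mapsTo hw)).1
  simp only [Pi.smul_apply, smul_eq_mul, h.areaVector_eq hw]
  field_simp

/-- In `Z_F = φ' · (Z_G ∘ φ)` the factor `φ'` is holomorphic, so `∂̄` passes it and the chain rule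
adds `conj φ'`. -/
theorem dzbar_zCoord (h : ParamChange F D G D' φ) (hw : w ∈ D) (k : Fin 3) :
    dzbar (fun p => zCoord F p k) w =
      Complex.normSq (deriv φ w) * dzbar (fun p => zCoord G p k) (φ w) := by
  have hd := h.right.differentiableAt_zCoord (h.mapsTo hw) k
  have hφ := h.differentiableAt hw
  have hφ' : DifferentiableAt ℂ (deriv φ) w :=
    (h.differentiableOn.deriv h.left.isOpen).differentiableAt (h.left.isOpen.mem_nhds hw)
  have hc : DifferentiableAt ℝ (fun p => zCoord G (φ p) k) w :=
    DifferentiableAt.comp w hd (hφ.restrictScalars ℝ)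
  have e : (fun p => zCoord F p k) =ᶠ[nhds w] fun p => deriv φ p * zCoord G (φ p) k := by
    filter_upwards [h.left.isOpen.mem_nhds hw] with p hp using h.zCoord_eq hp k
  rw [dzbar, e.fderiv_eq, ← dzbar, dzbar_mul (hφ'.restrictScalars ℝ) hc, dzbar_eq_zero hφ',
    dzbar_comp (g := fun q => zCoord G q k) hd hφ, ← Complex.mul_conj]
  ring

/-- Every term of the structure equation scales by `|φ'|²`, so `H` can be read off from a component
in which the area vector is nonzero; the second fundamental form need not be transformed. -/
theorem meanCurvatureAt_eq (h : ParamChange F D G D' φ) (hw : w ∈ D) :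
    meanCurvatureAt F w = meanCurvatureAt G (φ w) := by
  have hw' := h.mapsTo hw
  have hpos := h.normSq_deriv_pos hw
  obtain ⟨k, hk⟩ : ∃ k, areaVector G (φ w) k ≠ 0 := by
    by_contra! h0
    have h1 : areaVector G (φ w) = 0 := funext h0
    have h2 := h.right.areaVector_sq hw'
    rw [h1, zero_dotProduct] at h2
    exact (pow_pos (h.right.conformal _ hw').1 2).ne h2
  have e1 := h.dzbar_zCoord hw k
  rw [h.left.structure_eq hw, h.right.structure_eq hw', h.areaVector_eq hw, h.zCoord_eq hw,
    h.zCoord_eq hw, h.zCoord_eq hw] at e1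
  have e2 : (![-(deriv φ w * zCoord G (φ w) 1), deriv φ w * zCoord G (φ w) 0, 0] : Fin 3 → ℂ) k =
      deriv φ w * (![-zCoord G (φ w) 1, zCoord G (φ w) 0, 0] : Fin 3 → ℂ) k := by
    fin_cases k <;> simp
  rw [e2, ← Complex.mul_conj, map_mul] at e1
  have h3 : ((Complex.normSq (deriv φ w) * areaVector G (φ w) k : ℝ) : ℂ) ≠ 0 :=
    Complex.ofReal_ne_zero.2 (mul_ne_zero hpos.ne' hk)
  have h4 : (meanCurvatureAt F w : ℂ) = meanCurvatureAt G (φ w) := by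
    refine mul_right_cancel₀ h3 ?_
    push_cast at e1 ⊢
    rw [← Complex.mul_conj] at e1 ⊢
    linear_combination 2 * e1
  exact_mod_cast h4

theorem tangentSectionalAt_eq (h : ParamChange F D G D' φ) (hw : w ∈ D) :
    tangentSectionalAt F w = tangentSectionalAt G (φ w) := by
  rw [h.left.tangentSectionalAt_eq hw, h.right.tangentSectionalAt_eq (h.mapsTo hw),
    h.unitNormal_eq hw]

/-- `gradPairing` is the inner product of the surface gradient of `r` with `e₃`: numerator and
denominator both scale by `|φ'|²`. -/
theorem gradPairing_eq (h : ParamChange F D G D' φ) (hw : w ∈ D) {r s : ℂ → ℝ}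
    (hs : DifferentiableAt ℝ s (φ w)) (hr : ∀ p ∈ D, r p = s (φ p)) :
    gradPairing F r w = gradPairing G s (φ w) := by
  have e : r =ᶠ[nhds w] fun p => s (φ p) := by
    filter_upwards [h.left.isOpen.mem_nhds hw] with p hp using hr p hp
  have := (h.normSq_deriv_pos hw).ne'
  have := (h.right.conformal _ (h.mapsTo hw)).1
  rw [gradPairing, gradPairing, e.fderiv_eq, fderiv_comp_apply hs (h.differentiableAt hw),
    fderiv_comp_apply hs (h.differentiableAt hw), h.leftDeriv_eq hw, h.leftDeriv_eq hw,
    h.firstForm_eq hw, leftDeriv_eq_smul_add G _ (deriv φ w * 1),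
    leftDeriv_eq_smul_add G _ (deriv φ w * Complex.I), clm_apply_eq _ (deriv φ w * 1),
    clm_apply_eq _ (deriv φ w * Complex.I), div_eq_div_iff (by positivity) (by positivity),
    Complex.normSq_apply]
  simp
  ring

end ParamChange
end SLTilde

namespace SLTilde

/-! ### Local parameters and the area measure -/

theorem mem_overlap {M : Type*} [TopologicalSpace M] {e e' : OpenPartialHomeomorph M ℂ} {p : M}
    (hp : p ∈ e.source) (hp' : p ∈ e'.source) :
    e p ∈ e.target ∩ e.symm ⁻¹' e'.source :=
  ⟨e.map_source hp, by rwa [Set.mem_preimage, e.left_inv hp]⟩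

section Groupoid

theorem contDiffGroupoid_complex_le_real :
    contDiffGroupoid ω 𝓘(ℂ) ≤ contDiffGroupoid ∞ 𝓘(ℝ, ℂ) := by
  intro f hf
  change f ∈ contDiffGroupoid ω 𝓘(ℂ) at hf
  change f ∈ contDiffGroupoid ∞ 𝓘(ℝ, ℂ)
  rw [contDiffGroupoid, mem_groupoid_of_pregroupoid] at hf ⊢
  simp only [contDiffPregroupoid] at hf ⊢
  exact ⟨(hf.1.restrict_scalars ℝ).of_le le_top, (hf.2.restrict_scalars ℝ).of_le le_top⟩

variable {M : Type*} [TopologicalSpace M] [ChartedSpace ℂ M]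

theorem isManifold_real [IsManifold 𝓘(ℂ) ω M] : IsManifold 𝓘(ℝ, ℂ) ∞ M :=
  have : HasGroupoid M (contDiffGroupoid ω 𝓘(ℂ)) := inferInstance
  have : HasGroupoid M (contDiffGroupoid ∞ 𝓘(ℝ, ℂ)) :=
    hasGroupoid_of_le this contDiffGroupoid_complex_le_real
  IsManifold.mk' _ _ _

theorem localParams_subset_real :
    localParams M ⊆ IsManifold.maximalAtlas 𝓘(ℝ, ℂ) ∞ M :=
  StructureGroupoid.maximalAtlas_mono contDiffGroupoid_complex_le_real

theorem chartAt_mem_localParams [IsManifold 𝓘(ℂ) ω M] (p : M) : chartAt ℂ p ∈ localParams M :=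
  IsManifold.chart_mem_maximalAtlas p

theorem restr_mem_localParams {e : OpenPartialHomeomorph M ℂ} (he : e ∈ localParams M) {s : Set M}
    (hs : IsOpen s) : e.restr s ∈ localParams M :=
  restr_mem_maximalAtlas (contDiffGroupoid ω 𝓘(ℂ)) he hs

theorem differentiableOn_transition [IsManifold 𝓘(ℂ) ω M] {e e' : OpenPartialHomeomorph M ℂ}
    (he : e ∈ localParams M) (he' : e' ∈ localParams M) :
    DifferentiableOn ℂ (fun w => e' (e.symm w)) (e.target ∩ e.symm ⁻¹' e'.source) := by
  have h := StructureGroupoid.compatible_of_mem_maximalAtlas he he'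
  rw [contDiffGroupoid, mem_groupoid_of_pregroupoid] at h
  have h1 := h.1
  simp only [contDiffPregroupoid, modelWithCornersSelf_coe, modelWithCornersSelf_coe_symm,
    Set.range_id, Set.inter_univ, Set.preimage_id, OpenPartialHomeomorph.trans_source,
    OpenPartialHomeomorph.symm_source, CompTriple.comp_eq] at h1
  exact ContDiffOn.differentiableOn h1 (by simp)

end Groupoid

variable {M : Type*} [TopologicalSpace M] [ChartedSpace ℂ M] {f : M → SLTilde}
  {e e' : OpenPartialHomeomorph M ℂ}

theorem conformalOn_inParam [IsManifold 𝓘(ℂ) ω M] (hf : IsConformalImmersion f)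
    (he : e ∈ localParams M) : ConformalOn (inParam f e) e.target where
  isOpen := e.open_target
  smoothOn := by
    have := isManifold_real (M := M)
    have h1 : ContMDiff 𝓘(ℝ, ℂ) 𝓘(ℝ, ℂ × ℝ) ∞ (fun p => ((f p).1 : ℂ × ℝ)) :=
      contMDiff_subtype_val.comp hf.1
    have h2 := contMDiffOn_symm_of_mem_maximalAtlas (localParams_subset_real he)
    exact (h1.comp_contMDiffOn h2).contDiffOn
  conformal := hf.2 e he

/-- The overlap of two local parameters. -/
theorem paramChange [IsManifold 𝓘(ℂ) ω M] (hf : IsConformalImmersion f) (he : e ∈ localParams M)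
    (he' : e' ∈ localParams M) :
    ParamChange (inParam f e) (e.target ∩ e.symm ⁻¹' e'.source) (inParam f e') e'.target
      (fun w => e' (e.symm w)) where
  left := (conformalOn_inParam hf he).mono
    (e.symm.isOpen_inter_preimage e'.open_source) Set.inter_subset_left
  right := conformalOn_inParam hf he'
  differentiableOn := differentiableOn_transition he he'
  mapsTo := fun _ hw => e'.map_source hw.2
  eq := fun w hw => by simp only [inParam, Function.comp_apply, e'.left_inv hw.2]

/-- The density of the energy of the surface with respect to the area. -/
noncomputable def energyDensity (f : M → SLTilde) (p : M) : ℂ :=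
  energyDensityAt (inParam f (chartAt ℂ p)) (chartAt ℂ p p)

/-- A function given in the local parameters by expressions that agree on overlaps. -/
theorem chart_independent {E : Type*} [IsManifold 𝓘(ℂ) ω M] {q : OpenPartialHomeomorph M ℂ → ℂ → E}
    (hq : ∀ e ∈ localParams M, ∀ e' ∈ localParams M, ∀ w ∈ e.target ∩ e.symm ⁻¹' e'.source,
      q e w = q e' (e' (e.symm w))) (he : e ∈ localParams M) {p : M} (hp : p ∈ e.source) :
    q (chartAt ℂ p) (chartAt ℂ p p) = q e (e p) := by
  have := hq _ (chartAt_mem_localParams p) e he _ (mem_overlap (mem_chart_source ℂ p) hp)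
  rwa [(chartAt ℂ p).left_inv (mem_chart_source ℂ p)] at this

theorem chart_independent_symm {E : Type*} [IsManifold 𝓘(ℂ) ω M]
    {q : OpenPartialHomeomorph M ℂ → ℂ → E}
    (hq : ∀ e ∈ localParams M, ∀ e' ∈ localParams M, ∀ w ∈ e.target ∩ e.symm ⁻¹' e'.source,
      q e w = q e' (e' (e.symm w))) (he : e ∈ localParams M) {w : ℂ} (hw : w ∈ e.target) :
    q (chartAt ℂ (e.symm w)) (chartAt ℂ (e.symm w) (e.symm w)) = q e w := by
  rw [chart_independent hq he (e.map_target hw), e.right_inv hw]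

theorem continuous_of_local {E : Type*} [TopologicalSpace E] [IsManifold 𝓘(ℂ) ω M]
    {q : OpenPartialHomeomorph M ℂ → ℂ → E}
    (hq : ∀ e ∈ localParams M, ∀ e' ∈ localParams M, ∀ w ∈ e.target ∩ e.symm ⁻¹' e'.source,
      q e w = q e' (e' (e.symm w))) (hc : ∀ e ∈ localParams M, ContinuousOn (q e) e.target) :
    Continuous fun p => q (chartAt ℂ p) (chartAt ℂ p p) := by
  refine continuous_iff_continuousAt.2 fun p => ?_
  set e := chartAt ℂ p
  have he : e ∈ localParams M := chartAt_mem_localParams p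
  have hs : e.source ∈ nhds p := e.open_source.mem_nhds (mem_chart_source ℂ p)
  have : ContinuousOn (fun p => q (chartAt ℂ p) (chartAt ℂ p p)) e.source :=
    ((hc e he).comp e.continuousOn e.mapsTo).congr fun p' hp' => chart_independent hq he hp'
  exact this.continuousAt hs

section Invariance

variable [IsManifold 𝓘(ℂ) ω M]

theorem meanCurvature_invariant (hf : IsConformalImmersion f) : ∀ e ∈ localParams M,
    ∀ e' ∈ localParams M, ∀ w ∈ e.target ∩ e.symm ⁻¹' e'.source,
      meanCurvatureAt (inParam f e) w = meanCurvatureAt (inParam f e') (e' (e.symm w)) :=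
  fun _ he _ he' _ hw => (paramChange hf he he').meanCurvatureAt_eq hw

theorem tangentSectional_invariant (hf : IsConformalImmersion f) : ∀ e ∈ localParams M,
    ∀ e' ∈ localParams M, ∀ w ∈ e.target ∩ e.symm ⁻¹' e'.source,
      tangentSectionalAt (inParam f e) w = tangentSectionalAt (inParam f e') (e' (e.symm w)) :=
  fun _ he _ he' _ hw => (paramChange hf he he').tangentSectionalAt_eq hw

theorem unitNormal_invariant (hf : IsConformalImmersion f) : ∀ e ∈ localParams M,
    ∀ e' ∈ localParams M, ∀ w ∈ e.target ∩ e.symm ⁻¹' e'.source,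
      unitNormal (inParam f e) w = unitNormal (inParam f e') (e' (e.symm w)) :=
  fun _ he _ he' _ hw => (paramChange hf he he').unitNormal_eq hw

end Invariance

/-! #### The area measure -/

open MeasureTheory

/-- The area measure in a local parameter. -/
noncomputable def localArea [MeasurableSpace M] (f : M → SLTilde) (e : OpenPartialHomeomorph M ℂ) :
    Measure M :=
  ((volume.restrict e.target).withDensity
    fun w => ENNReal.ofReal (Real.sqrt (gramDet (inParam f e) w))).map e.symm

theorem areaMeasure_eq [MeasurableSpace M] (f : M → SLTilde) :
    areaMeasure f = ⨆ e ∈ localParams M, localArea f e := rfl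

variable [MeasurableSpace M] [BorelSpace M]

theorem measurableSet_target_inter {M : Type*} [TopologicalSpace M] [MeasurableSpace M] [BorelSpace M]
    (e : OpenPartialHomeomorph M ℂ) {s : Set M}
    (hs : MeasurableSet s) : MeasurableSet (e.target ∩ e.symm ⁻¹' s) := by
  have hc : Continuous (e.target.domRestrict e.symm) :=
    continuousOn_iff_continuous_domRestrict.1 e.continuousOn_symm
  have h := e.open_target.measurableSet.subtype_image (hc.measurable hs)
  convert h using 1
  ext w
  simp [and_comm]

theorem aemeasurable_symm {M : Type*} [TopologicalSpace M] [MeasurableSpace M] [BorelSpace M]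
    (f : M → SLTilde) (e : OpenPartialHomeomorph M ℂ) :
    AEMeasurable e.symm ((volume.restrict e.target).withDensity
      fun w => ENNReal.ofReal (Real.sqrt (gramDet (inParam f e) w))) :=
  (e.continuousOn_symm.aemeasurable e.open_target.measurableSet).mono_ac
    (withDensity_absolutelyContinuous _ _)

theorem localArea_apply {M : Type*} [TopologicalSpace M] [MeasurableSpace M] [BorelSpace M]
    (f : M → SLTilde) (e : OpenPartialHomeomorph M ℂ) {s : Set M}
    (hs : MeasurableSet s) : localArea f e s =
      ∫⁻ w in e.target ∩ e.symm ⁻¹' s, ENNReal.ofReal (Real.sqrt (gramDet (inParam f e) w)) := by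
  rw [localArea, Measure.map_apply_of_aemeasurable (aemeasurable_symm f e) hs,
    withDensity_apply', Measure.restrict_restrict' e.open_target.measurableSet, Set.inter_comm]

theorem localArea_inter_source {M : Type*} [TopologicalSpace M] [MeasurableSpace M] [BorelSpace M]
    (f : M → SLTilde) (e : OpenPartialHomeomorph M ℂ) {s : Set M}
    (hs : MeasurableSet s) : localArea f e (s ∩ e.source) = localArea f e s := by
  rw [localArea_apply f e hs, localArea_apply f e (hs.inter e.open_source.measurableSet)]
  congr 2
  ext w
  constructor
  · exact fun h => ⟨h.1, h.2.1⟩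
  · exact fun h => ⟨h.1, h.2, e.map_target h.1⟩

theorem det_fderiv_real {φ : ℂ → ℂ} {w : ℂ} (hφ : DifferentiableAt ℂ φ w) :
    (fderiv ℝ φ w).det = Complex.normSq (deriv φ w) := by
  rw [(hφ.hasDerivAt.hasFDerivAt.restrictScalars ℝ).fderiv]
  simp [ContinuousLinearMap.det, LinearMap.det_restrictScalars, Algebra.norm_complex_eq]

variable [IsManifold 𝓘(ℂ) ω M]

/-- Change of variables: the real Jacobian of the holomorphic transition map is `|φ'|²`, exactly the
ratio of the conformal factors. -/
theorem localArea_eq (hf : IsConformalImmersion f) (he : e ∈ localParams M)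
    (he' : e' ∈ localParams M) {s : Set M} (hs : MeasurableSet s) (hse : s ⊆ e.source)
    (hse' : s ⊆ e'.source) : localArea f e s = localArea f e' s := by
  have hch := paramChange hf he he'
  set φ : ℂ → ℂ := fun w => e' (e.symm w) with hφ
  set A := e.target ∩ e.symm ⁻¹' s with hA
  have hAD : A ⊆ e.target ∩ e.symm ⁻¹' e'.source := fun w hw => ⟨hw.1, hse' hw.2⟩
  have hAm : MeasurableSet A := measurableSet_target_inter e hs
  have himg : e'.target ∩ e'.symm ⁻¹' s = φ '' A := by
    ext w
    constructor
    · rintro ⟨h1, h2⟩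
      refine ⟨e (e'.symm w), ⟨e.map_source (hse h2), ?_⟩, ?_⟩
      · rwa [Set.mem_preimage, e.left_inv (hse h2)]
      · simp only [hφ, e.left_inv (hse h2), e'.right_inv h1]
    · rintro ⟨p, ⟨h1, h2⟩, rfl⟩
      refine ⟨e'.map_source (hse' h2), ?_⟩
      rwa [Set.mem_preimage, e'.left_inv (hse' h2)]
  have hinj : Set.InjOn φ A := by
    intro a ha b hb hab
    exact e.symm.injOn ha.1 hb.1 (e'.injOn (hse' ha.2) (hse' hb.2) hab)
  rw [localArea_apply f e hs, localArea_apply f e' hs, himg,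
    lintegral_image_eq_lintegral_abs_det_fderiv_mul volume hAm
      (fun w hw => ((hch.differentiableAt (hAD hw)).restrictScalars
        ℝ).hasFDerivAt.hasFDerivWithinAt) hinj]
  refine setLIntegral_congr_fun hAm fun w hw => ?_
  have hw' := hAD hw
  rw [det_fderiv_real (hch.differentiableAt hw'), ← ENNReal.ofReal_mul (abs_nonneg _),
    hch.left.sqrt_gramDet hw', hch.right.sqrt_gramDet (hch.mapsTo hw'), hch.firstForm_eq hw',
    abs_of_nonneg (Complex.normSq_nonneg _)]

/-- The measure is assembled chart by chart, each new chart contributing only the part of its domain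
not yet covered, so that no area is counted twice. -/
theorem exists_measure_eq_localArea (hf : IsConformalImmersion f) (t : Finset M) :
    ∃ ν : Measure M, ∀ e ∈ localParams M, ∀ s, MeasurableSet s → s ⊆ e.source →
      ν s = localArea f e (s ∩ ⋃ p ∈ t, (chartAt ℂ p).source) := by
  classical
  induction t using Finset.induction_on with
  | empty => exact ⟨0, fun e _ s _ _ => by simp⟩
  | insert a t _ ih =>
    obtain ⟨ν, hν⟩ := ih
    set u := ⋃ p ∈ t, (chartAt ℂ p).source with hu
    have hum : MeasurableSet u :=
      (isOpen_biUnion fun p _ => (chartAt ℂ p).open_source).measurableSet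
    have ham : MeasurableSet (chartAt ℂ a).source := (chartAt ℂ a).open_source.measurableSet
    refine ⟨ν + (localArea f (chartAt ℂ a)).restrict ((chartAt ℂ a).source \ u),
      fun e he s hs hse => ?_⟩
    rw [Measure.add_apply, hν e he s hs hse, Measure.restrict_apply hs,
      localArea_eq hf (chartAt_mem_localParams a) he (hs.inter (ham.diff hum))
        (fun p hp => hp.2.1) (fun p hp => hse hp.1), Finset.set_biUnion_insert, ← hu,
      ← measure_union _ (hs.inter (ham.diff hum)), ← Set.inter_union_distrib_left,
      Set.union_sdiff_self, Set.union_comm]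
    exact Set.disjoint_left.2 fun p hp hp' => hp'.2.2 hp.2

/-- A supremum of measures is not the setwise supremum, so an upper bound is needed. A finite chart
cover yields a measure `ν` that agrees with each local area on its domain; hence the supremum is at
most `ν`, and it is at least each local area. -/
theorem areaMeasure_restrict [CompactSpace M] (hf : IsConformalImmersion f)
    (he : e ∈ localParams M) : (areaMeasure f).restrict e.source = localArea f e := by
  obtain ⟨t, ht⟩ := isCompact_univ.elim_finite_subcover (fun p : M => (chartAt ℂ p).source)
    (fun p => (chartAt ℂ p).open_source) fun p _ => Set.mem_iUnion.2 ⟨p, mem_chart_source ℂ p⟩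
  obtain ⟨ν, hν⟩ := exists_measure_eq_localArea hf t
  simp only [Set.univ_subset_iff.1 ht, Set.inter_univ] at hν
  have hle : areaMeasure f ≤ ν := by
    rw [areaMeasure_eq]
    refine iSup₂_le fun e' he' => Measure.le_iff.2 fun s hs => ?_
    rw [← localArea_inter_source f e' hs, ← hν e' he' _ (hs.inter e'.open_source.measurableSet)
      Set.inter_subset_right]
    exact measure_mono Set.inter_subset_left
  have hge : localArea f e ≤ areaMeasure f := by
    rw [areaMeasure_eq]
    exact le_iSup₂ (f := fun e (_ : e ∈ localParams M) => localArea f e) e he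
  ext s hs
  rw [Measure.restrict_apply hs]
  refine le_antisymm ?_ ?_
  · refine (hle _).trans ?_
    rw [hν e he _ (hs.inter e.open_source.measurableSet) Set.inter_subset_right]
    exact measure_mono Set.inter_subset_left
  · rw [← localArea_inter_source f e hs]
    exact hge _

/-- Integration over the surface of a function supported in the domain of a local parameter. -/
theorem integral_areaMeasure_of_tsupport [CompactSpace M] {E : Type*} [NormedAddCommGroup E]
    [NormedSpace ℝ E] [SecondCountableTopology E] (hf : IsConformalImmersion f)
    (he : e ∈ localParams M) {g : M → E} (hg : Continuous g) (hs : tsupport g ⊆ e.source) :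
    Integrable g (areaMeasure f) ∧ ∫ p, g p ∂(areaMeasure f) =
      ∫ w in e.target, firstForm (inParam f e) w 1 1 • g (e.symm w) := by
  have hF := conformalOn_inParam hf he
  have hsub : Function.support g ⊆ e.source := (subset_tsupport g).trans hs
  have hK : IsCompact (e '' tsupport g) :=
    (isClosed_tsupport g).isCompact.image_of_continuousOn (e.continuousOn.mono hs)
  have hKt : e '' tsupport g ⊆ e.target := by
    rintro _ ⟨p, hp, rfl⟩
    exact e.map_source (hs hp)
  have hcont : ContinuousOn (fun w => firstForm (inParam f e) w 1 1 • g (e.symm w)) e.target :=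
    (hF.continuousOn_firstForm 1 1).smul (hg.comp_continuousOn e.continuousOn_symm)
  have hzero : ∀ w ∈ e.target, w ∉ e '' tsupport g → g (e.symm w) = 0 := by
    intro w hw hwK
    by_contra h0
    exact hwK ⟨e.symm w, subset_tsupport g h0, e.right_inv hw⟩
  -- The local area may be infinite; the integrand is continuous and vanishes off the compact image
  -- of the support.
  have hint : IntegrableOn (fun w => firstForm (inParam f e) w 1 1 • g (e.symm w)) e.target :=
    ((hcont.mono hKt).integrableOn_compact hK).of_forall_sdiff_eq_zero
      e.open_target.measurableSet fun w hw => by rw [hzero w hw.1 hw.2, smul_zero]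
  have hdm : AEMeasurable (fun w => ENNReal.ofReal (Real.sqrt (gramDet (inParam f e) w)))
      (volume.restrict e.target) := by
    refine ContinuousOn.aemeasurable ?_ e.open_target.measurableSet
    exact ENNReal.continuous_ofReal.comp_continuousOn
      ((hF.continuousOn_firstForm 1 1).congr fun w hw => hF.sqrt_gramDet hw)
  have hlt : ∀ᵐ w ∂(volume.restrict e.target),
      ENNReal.ofReal (Real.sqrt (gramDet (inParam f e) w)) < ⊤ :=
    Filter.Eventually.of_forall fun w => ENNReal.ofReal_lt_top
  have hcongr : ∀ w ∈ e.target,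
      (ENNReal.ofReal (Real.sqrt (gramDet (inParam f e) w))).toReal • g (e.symm w) =
        firstForm (inParam f e) w 1 1 • g (e.symm w) := fun w hw => by
    rw [ENNReal.toReal_ofReal (Real.sqrt_nonneg _), hF.sqrt_gramDet hw]
  constructor
  · rw [← integrableOn_iff_integrable_of_support_subset hsub, IntegrableOn,
      areaMeasure_restrict hf he, localArea,
      integrable_map_measure hg.aestronglyMeasurable (aemeasurable_symm f e),
      integrable_withDensity_iff_integrable_smul₀' hdm hlt]
    exact hint.congr_fun (fun w hw => (hcongr w hw).symm) e.open_target.measurableSet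
  · rw [← setIntegral_eq_integral_of_forall_compl_eq_zero (s := e.source)
      fun p hp => by_contra fun h0 => hp (hsub h0), areaMeasure_restrict hf he, localArea,
      integral_map (aemeasurable_symm f e) hg.aestronglyMeasurable,
      integral_withDensity_eq_integral_toReal_smul₀ hdm hlt]
    exact setIntegral_congr_fun e.open_target.measurableSet hcongr

/-- Integration over the surface by means of a partition of unity. -/
theorem integral_areaMeasure [CompactSpace M] {E : Type*} [NormedAddCommGroup E]
    [NormedSpace ℝ E] [SecondCountableTopology E] (hf : IsConformalImmersion f) {ι : Type*}
    [Fintype ι] {c : ι → OpenPartialHomeomorph M ℂ} (hc : ∀ i, c i ∈ localParams M)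
    (ρ : PartitionOfUnity ι M Set.univ) (hρ : ρ.IsSubordinate fun i => (c i).source)
    {g : M → E} (hg : Continuous g) :
    Integrable g (areaMeasure f) ∧ ∫ p, g p ∂(areaMeasure f) =
      ∑ i, ∫ w in (c i).target,
        firstForm (inParam f (c i)) w 1 1 • (ρ i ((c i).symm w) • g ((c i).symm w)) := by
  have h (i) := integral_areaMeasure_of_tsupport hf (hc i)
    (g := fun p => ρ i p • g p) ((ρ i).continuous.smul hg)
    ((closure_mono (Function.support_smul_subset_left _ _)).trans (hρ i))
  have hsum : g = fun p => ∑ i, ρ i p • g p := by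
    ext p
    rw [← Finset.sum_smul, ← finsum_eq_sum_of_fintype, ρ.sum_eq_one (Set.mem_univ p), one_smul]
  constructor
  · rw [hsum]
    exact integrable_finsetSum _ fun i _ => (h i).1
  · conv_lhs => rw [hsum]
    rw [integral_finsetSum _ fun i _ => (h i).1]
    exact Finset.sum_congr rfl fun i _ => (h i).2

end SLTilde

namespace SLTilde

open MeasureTheory

/-! ### The integral of the mean curvature against the Killing field `e₃` -/

/-- Extension by zero is smooth on the whole plane with compact support, and integration by parts
against the constant `1` applies. -/
theorem integral_fderiv_eq_zero {D K : Set ℂ} {g : ℂ → ℝ} (hD : IsOpen D) (hK : IsCompact K)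
    (hKD : K ⊆ D) (hg : ContDiffOn ℝ ∞ g D) (h0 : ∀ w ∈ D, w ∉ K → g w = 0) (v : ℂ) :
    IntegrableOn (fun w => fderiv ℝ g w v) D ∧ ∫ w in D, fderiv ℝ g w v = 0 := by
  set G : ℂ → ℝ := D.indicator g with hG
  have e1 : ∀ w ∈ D, G =ᶠ[nhds w] g := fun w hw => by
    filter_upwards [hD.mem_nhds hw] with p hp using Set.indicator_of_mem hp g
  have e2 : ∀ w ∉ K, G =ᶠ[nhds w] fun _ => 0 := fun w hw => by
    filter_upwards [hK.isClosed.isOpen_compl.mem_nhds hw] with p hp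
    by_cases hpD : p ∈ D
    · rw [hG, Set.indicator_of_mem hpD, h0 p hpD hp]
    · rw [hG, Set.indicator_of_notMem hpD]
  have hcd : ContDiff ℝ ∞ G := contDiff_iff_contDiffAt.2 fun w => by
    by_cases hw : w ∈ D
    · exact (hg.contDiffAt (hD.mem_nhds hw)).congr_of_eventuallyEq (e1 w hw)
    · exact contDiffAt_const.congr_of_eventuallyEq (e2 w fun h => hw (hKD h))
  have hsupp : HasCompactSupport G := HasCompactSupport.intro hK fun w hw => (e2 w hw).eq_of_nhds
  have hfd : (fun w => fderiv ℝ G w v) = D.indicator fun w => fderiv ℝ g w v := by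
    ext w
    by_cases hw : w ∈ D
    · rw [Set.indicator_of_mem hw, (e1 w hw).fderiv_eq]
    · rw [Set.indicator_of_notMem hw, (e2 w fun h => hw (hKD h)).fderiv_eq]
      simp
  have hi : Integrable fun w => fderiv ℝ G w v := by
    refine Continuous.integrable_of_hasCompactSupport ?_ ?_
    · exact (hcd.continuous_fderiv (by simp)).clm_apply continuous_const
    · exact hsupp.fderiv_apply ℝ v
  have hz : ∫ w, fderiv ℝ G w v = 0 := by
    have h := integral_mul_fderiv_eq_neg_fderiv_mul_of_integrable (μ := volume) (𝕜 := ℝ)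
      (f := fun _ : ℂ => (1 : ℝ)) (g := G) (v := v) (by simp) (by simpa using hi)
      (by simpa using hcd.continuous.integrable_of_hasCompactSupport hsupp)
      (fun w _ => by fun_prop) (fun w _ => hcd.differentiable (by simp) w)
    simpa using h
  rw [hfd] at hi hz
  exact ⟨(integrable_indicator_iff hD.measurableSet).1 hi,
    by rwa [integral_indicator hD.measurableSet] at hz⟩

section Local

variable {F : ℂ → SLTilde} {D K : Set ℂ} {w : ℂ} {r : ℂ → ℝ}

/-- The `e₃` component of `∇_x x` is zero for all `x`, which expresses that `e₃` is Killing; hence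
the tension equation has no connection term in this component. -/
theorem ConformalOn.divergence_eq (h : ConformalOn F D) (hw : w ∈ D) :
    derivLeft F w 1 1 2 + derivLeft F w Complex.I Complex.I 2 =
      2 * (firstForm F w 1 1 * (meanCurvatureAt F w * unitNormal F w 2)) := by
  have hT := congrFun (h.tension_eq hw) 2
  have hT' : derivLeft F w 1 1 2 + nabla (leftDeriv F w 1) (leftDeriv F w 1) 2 +
      (derivLeft F w Complex.I Complex.I 2 +
        nabla (leftDeriv F w Complex.I) (leftDeriv F w Complex.I) 2) =
      2 * meanCurvatureAt F w * areaVector F w 2 := hT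
  have := (h.conformal w hw).1
  rw [h.unitNormal_eq hw]
  simp only [nabla_apply, Matrix.cons_val, Pi.smul_apply, smul_eq_mul] at hT' ⊢
  field_simp
  linear_combination hT'

/-- The derivatives `∂ₓ(r X₃) + ∂_y(r Y₃)` integrate to zero, and the product rule splits their sum
into `λ` times `gradPairing` and `2 r λ H N₃`. -/
theorem ConformalOn.integral_meanCurvature_mul (h : ConformalOn F D) (hK : IsCompact K)
    (hKD : K ⊆ D) (hr : ContDiffOn ℝ ∞ r D) (h0 : ∀ w ∈ D, w ∉ K → r w = 0) :
    ∫ w in D, firstForm F w 1 1 • (r w • (meanCurvatureAt F w * unitNormal F w 2)) =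
      -(1 / 2) * ∫ w in D, firstForm F w 1 1 • gradPairing F r w := by
  have hθ (v : ℂ) := h.smoothOn.leftDeriv h.isOpen v 2
  have hd (v : ℂ) := integral_fderiv_eq_zero h.isOpen hK hKD (hr.mul (hθ v))
    (fun w hw hwK => by simp [h0 w hw hwK]) v
  have hmul (v : ℂ) : ∀ w ∈ D, fderiv ℝ (fun p => r p * leftDeriv F p v 2) w v =
      r w * derivLeft F w v v 2 + leftDeriv F w v 2 * fderiv ℝ r w v := fun w hw => by
    have h1 := (hr.contDiffAt (h.isOpen.mem_nhds hw)).differentiableAt (by simp)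
    rw [fderiv_fun_mul h1 (h.differentiableAt_leftDeriv hw v 2)]
    rfl
  have hsum : ∫ w in D, (firstForm F w 1 1 • gradPairing F r w + 2 *
      (firstForm F w 1 1 • (r w • (meanCurvatureAt F w * unitNormal F w 2)))) = 0 := by
    have hz := integral_add (hd 1).1 (hd Complex.I).1
    rw [(hd 1).2, (hd Complex.I).2, add_zero] at hz
    refine Eq.trans (setIntegral_congr_fun h.isOpen.measurableSet fun w hw => ?_) hz
    rw [hmul 1 w hw, hmul Complex.I w hw, gradPairing]
    have := (h.conformal w hw).1
    simp only [smul_eq_mul]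
    rw [mul_div_cancel₀ _ this.ne']
    linear_combination -r w * h.divergence_eq hw
  have hcr : ContinuousOn r D := hr.continuousOn
  have hi : IntegrableOn (fun w => firstForm F w 1 1 •
      (r w • (meanCurvatureAt F w * unitNormal F w 2))) D := by
    have hc : ContinuousOn (fun w => firstForm F w 1 1 •
        (r w • (meanCurvatureAt F w * unitNormal F w 2))) D :=
      (h.continuousOn_firstForm 1 1).smul (hcr.smul
        (h.continuousOn_meanCurvatureAt.mul (h.continuousOn_unitNormal 2)))
    exact ((hc.mono hKD).integrableOn_compact hK).of_forall_sdiff_eq_zero h.isOpen.measurableSet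
      fun w hw => by rw [h0 w hw.1 hw.2, zero_smul, smul_zero]
  have hi' : IntegrableOn (fun w => firstForm F w 1 1 • gradPairing F r w) D := by
    refine (((hd 1).1.add (hd Complex.I).1).sub (hi.const_mul 2)).congr_fun ?_
      h.isOpen.measurableSet
    intro w hw
    simp only [Pi.add_apply, Pi.sub_apply]
    rw [hmul 1 w hw, hmul Complex.I w hw, gradPairing]
    have := (h.conformal w hw).1
    simp only [smul_eq_mul]
    rw [mul_div_cancel₀ _ this.ne']
    linear_combination r w * h.divergence_eq hw
  rw [integral_add hi' (hi.const_mul 2), integral_const_mul] at hsum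
  linarith

theorem ConformalOn.continuousOn_gradPairing (h : ConformalOn F D) (hr : ContDiffOn ℝ ∞ r D) :
    ContinuousOn (gradPairing F r) D := by
  have hfd (v : ℂ) : ContinuousOn (fun w => fderiv ℝ r w v) D :=
    ((hr.fderiv_of_isOpen (m := ∞) h.isOpen (by simp)).clm_apply contDiffOn_const).continuousOn
  exact (((hfd 1).mul (h.continuousOn_leftDeriv 1 2)).add
    ((hfd Complex.I).mul (h.continuousOn_leftDeriv Complex.I 2))).div
    (h.continuousOn_firstForm 1 1) fun w hw => (h.conformal w hw).1.ne'

end Local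

variable {M : Type*} [TopologicalSpace M] [ChartedSpace ℂ M] {f : M → SLTilde}
  {e e' : OpenPartialHomeomorph M ℂ} [IsManifold 𝓘(ℂ) ω M]

theorem contDiffOn_comp_symm {r : M → ℝ} (hr : ContMDiff 𝓘(ℝ, ℂ) 𝓘(ℝ) ∞ r)
    (he : e ∈ localParams M) : ContDiffOn ℝ ∞ (fun w => r (e.symm w)) e.target := by
  have := isManifold_real (M := M)
  exact (hr.comp_contMDiffOn
    (contMDiffOn_symm_of_mem_maximalAtlas (localParams_subset_real he))).contDiffOn

theorem gradPairing_invariant (hf : IsConformalImmersion f) {r : M → ℝ}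
    (hr : ContMDiff 𝓘(ℝ, ℂ) 𝓘(ℝ) ∞ r) : ∀ e ∈ localParams M,
    ∀ e' ∈ localParams M, ∀ w ∈ e.target ∩ e.symm ⁻¹' e'.source,
      gradPairing (inParam f e) (fun w => r (e.symm w)) w =
        gradPairing (inParam f e') (fun w => r (e'.symm w)) (e' (e.symm w)) := by
  intro e he e' he' w hw
  refine (paramChange hf he he').gradPairing_eq hw ?_ fun p hp => ?_
  · exact ((contDiffOn_comp_symm hr he').contDiffAt
      (e'.open_target.mem_nhds (e'.map_source hw.2))).differentiableAt (by simp)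
  · rw [e'.left_inv hp.2]

theorem energyDensity_invariant (hf : IsConformalImmersion f) : ∀ e ∈ localParams M,
    ∀ e' ∈ localParams M, ∀ w ∈ e.target ∩ e.symm ⁻¹' e'.source,
      energyDensityAt (inParam f e) w = energyDensityAt (inParam f e') (e' (e.symm w)) :=
  fun e he e' he' w hw => by
    rw [energyDensityAt, energyDensityAt, meanCurvature_invariant hf e he e' he' w hw,
      unitNormal_invariant hf e he e' he' w hw, tangentSectional_invariant hf e he e' he' w hw]

/-! ### Global integrals over the compact surface and the value of the energy -/

variable [T2Space M] [CompactSpace M]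

/-- `IsEnergy` asks for spinors on the whole target of each parameter, so charts are shrunk to where
a spinor exists before a finite subcover is chosen. -/
theorem exists_isEnergy (hf : IsConformalImmersion f) : ∃ E, IsEnergy f E := by
  have hloc (p : M) : ∃ e ∈ localParams M, p ∈ e.source ∧ ∃ ψ₁ ψ₂ : ℂ → ℂ,
      IsGeneratingSpinor (inParam f e) e.target ψ₁ ψ₂ := by
    set e := chartAt ℂ p with he
    have hem : e ∈ localParams M := chartAt_mem_localParams p
    have hp : p ∈ e.source := mem_chart_source ℂ p
    obtain ⟨D, hDs, hDo, hpD, ψ₁, ψ₂, h1, h2, h3⟩ :=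
      (conformalOn_inParam hf hem).exists_spinor (e.map_source hp)
    have hso : IsOpen (e.source ∩ e ⁻¹' D) := e.isOpen_inter_preimage hDo
    refine ⟨e.restr (e.source ∩ e ⁻¹' D), restr_mem_localParams hem hso, ?_, ψ₁, ψ₂, ?_⟩
    · rw [e.restr_source' _ hso]
      exact ⟨hp, hp, hpD⟩
    · have hsub : (e.restr (e.source ∩ e ⁻¹' D)).target ⊆ D := by
        intro w hw
        have hw' := (e.restr (e.source ∩ e ⁻¹' D)).map_target hw
        rw [e.restr_source' _ hso] at hw'
        have h4 := hw'.2.2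
        have h5 := (e.restr (e.source ∩ e ⁻¹' D)).right_inv hw
        rw [e.restr_apply] at h5
        rwa [Set.mem_preimage, h5] at h4
      exact ⟨h1.mono hsub, h2.mono hsub, fun w hw => h3 w (hsub hw)⟩
  choose c hc hcp ψ₁ ψ₂ hψ using hloc
  obtain ⟨t, ht⟩ := isCompact_univ.elim_finite_subcover (fun p : M => (c p).source)
    (fun p => (c p).open_source) fun p _ => Set.mem_iUnion.2 ⟨p, hcp p⟩
  set x : Fin t.card → M := fun i => t.equivFin.symm i with hx
  have hcov : Set.univ ⊆ ⋃ i, (c (x i)).source := by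
    intro p hp
    obtain ⟨q, hq, hpq⟩ := Set.mem_iUnion₂.1 (ht hp)
    exact Set.mem_iUnion.2 ⟨t.equivFin ⟨q, hq⟩, by simpa [hx] using hpq⟩
  obtain ⟨ρ, hρ⟩ := PartitionOfUnity.exists_isSubordinate isClosed_univ
    (fun i => (c (x i)).source) (fun i => (c (x i)).open_source) hcov
  exact ⟨_, t.card, fun i => c (x i), fun i => ψ₁ (x i), fun i => ψ₂ (x i), _, _, ρ,
    fun i => ⟨hc _, hψ _, (conformalOn_inParam hf (hc (x i))).isDiracPotential (hψ _)⟩, hρ, rfl⟩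

variable [MeasurableSpace M] [BorelSpace M]

/-- The divergence theorem for the tangential part of `e₃`, localized by a smooth partition of unity
`ρ`: each piece leaves a term with `dρ i`, and these add up to `d1 = 0`. -/
theorem integral_meanCurvature_mul_unitNormal (hf : IsConformalImmersion f) :
    Integrable (fun p => meanCurvature f p *
      unitNormal (inParam f (chartAt ℂ p)) (chartAt ℂ p p) 2) (areaMeasure f) ∧
    ∫ p, meanCurvature f p * unitNormal (inParam f (chartAt ℂ p)) (chartAt ℂ p p) 2
      ∂(areaMeasure f) = 0 := by
  have := isManifold_real (M := M)
  obtain ⟨t, ht⟩ := isCompact_univ.elim_finite_subcover (fun p : M => (chartAt ℂ p).source)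
    (fun p => (chartAt ℂ p).open_source) fun p _ => Set.mem_iUnion.2 ⟨p, mem_chart_source ℂ p⟩
  set c : t → OpenPartialHomeomorph M ℂ := fun i => chartAt ℂ (i : M) with hc
  have hcm (i) : c i ∈ localParams M := chartAt_mem_localParams _
  obtain ⟨ρ, hρ⟩ := SmoothPartitionOfUnity.exists_isSubordinate 𝓘(ℝ, ℂ) isClosed_univ
    (fun i => (c i).source) (fun i => (c i).open_source)
    (by simpa [Set.iUnion_subtype, hc] using ht)
  have hinv : ∀ e ∈ localParams M, ∀ e' ∈ localParams M, ∀ w ∈ e.target ∩ e.symm ⁻¹' e'.source,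
      meanCurvatureAt (inParam f e) w * unitNormal (inParam f e) w 2 =
        meanCurvatureAt (inParam f e') (e' (e.symm w)) *
          unitNormal (inParam f e') (e' (e.symm w)) 2 := fun e he e' he' w hw => by
    rw [meanCurvature_invariant hf e he e' he' w hw, unitNormal_invariant hf e he e' he' w hw]
  have hcont := continuous_of_local hinv fun e he =>
    (conformalOn_inParam hf he).continuousOn_meanCurvatureAt.mul
      ((conformalOn_inParam hf he).continuousOn_unitNormal 2)
  obtain ⟨hint, heq⟩ := integral_areaMeasure hf hcm ρ.toPartitionOfUnity hρ.toPartitionOfUnity hcont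
  refine ⟨hint, heq.trans ?_⟩
  have hq (i) := gradPairing_invariant hf (ρ i).contMDiff
  have hqc (i) := continuous_of_local (hq i) fun e he =>
    (conformalOn_inParam hf he).continuousOn_gradPairing
      (contDiffOn_comp_symm (ρ i).contMDiff he)
  -- Off the support of `ρ i` the function vanishes near the point, hence so does its derivative.
  have hqs (i) : tsupport (fun p => gradPairing (inParam f (chartAt ℂ p))
      (fun w => ρ i ((chartAt ℂ p).symm w)) (chartAt ℂ p p)) ⊆ (c i).source := by
    refine (closure_minimal ?_ (isClosed_tsupport (ρ i))).trans (hρ i)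
    intro p hp
    by_contra hps
    refine hp ?_
    set e := chartAt ℂ p
    have hz : (fun w => ρ i (e.symm w)) =ᶠ[nhds (e p)] fun _ => 0 := by
      have h1 : Filter.Tendsto e.symm (nhds (e p)) (nhds p) :=
        e.tendsto_symm (mem_chart_source ℂ p)
      filter_upwards [h1 ((isClosed_tsupport (ρ i)).isOpen_compl.mem_nhds hps)] with w hw
      exact image_eq_zero_of_notMem_tsupport hw
    change gradPairing (inParam f e) (fun w => ρ i (e.symm w)) (e p) = 0
    rw [gradPairing, hz.fderiv_eq]
    simp
  -- The boundary-free term is rewritten as an integral over all of `M`, so that the sum over `i`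
  -- can be taken pointwise.
  have hterm (i) : ∫ w in (c i).target, firstForm (inParam f (c i)) w 1 1 •
      (ρ i ((c i).symm w) • (meanCurvatureAt (inParam f (c i)) w *
        unitNormal (inParam f (c i)) w 2)) =
      -(1 / 2) * ∫ p, gradPairing (inParam f (chartAt ℂ p))
        (fun w => ρ i ((chartAt ℂ p).symm w)) (chartAt ℂ p p) ∂(areaMeasure f) := by
    rw [(conformalOn_inParam hf (hcm i)).integral_meanCurvature_mul (K := c i '' tsupport (ρ i))
      ((isClosed_tsupport _).isCompact.image_of_continuousOn ((c i).continuousOn.mono (hρ i)))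
      (by rintro _ ⟨p, hp, rfl⟩; exact (c i).map_source (hρ i hp))
      (contDiffOn_comp_symm (ρ i).contMDiff (hcm i)) ?_,
      (integral_areaMeasure_of_tsupport hf (hcm i) (hqc i) (hqs i)).2]
    · congr 1
      refine setIntegral_congr_fun (c i).open_target.measurableSet fun w hw => ?_
      rw [chart_independent_symm (hq i) (hcm i) hw]
    · intro w hw hwK
      by_contra h0
      exact hwK ⟨(c i).symm w, subset_tsupport _ h0, (c i).right_inv hw⟩
  have hsum (p : M) : ∑ i, gradPairing (inParam f (chartAt ℂ p))
      (fun w => ρ i ((chartAt ℂ p).symm w)) (chartAt ℂ p p) = 0 := by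
    set e := chartAt ℂ p
    have hd (i) : DifferentiableAt ℝ (fun w => ρ i (e.symm w)) (e p) :=
      ((contDiffOn_comp_symm (ρ i).contMDiff (chartAt_mem_localParams p)).contDiffAt
        (e.open_target.mem_nhds (mem_chart_target ℂ p))).differentiableAt (by simp)
    have hone : (fun w => ∑ i, ρ i (e.symm w)) = fun _ => (1 : ℝ) := by
      ext w
      rw [← finsum_eq_sum_of_fintype, ρ.sum_eq_one (Set.mem_univ _)]
    have hfd (v : ℂ) : ∑ i, fderiv ℝ (fun w => ρ i (e.symm w)) (e p) v = 0 := by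
      have h1 := fderiv_fun_sum (u := Finset.univ) fun i _ => hd i
      rw [hone] at h1
      have h2 := congrArg (fun L : ℂ →L[ℝ] ℝ => L v) h1
      simpa using h2.symm
    simp only [gradPairing]
    rw [← Finset.sum_div, Finset.sum_add_distrib, ← Finset.sum_mul, ← Finset.sum_mul, hfd, hfd]
    simp
  calc _ = ∑ i, ∫ w in (c i).target, firstForm (inParam f (c i)) w 1 1 •
        (ρ i ((c i).symm w) • (meanCurvatureAt (inParam f (c i)) w *
          unitNormal (inParam f (c i)) w 2)) := by
        refine Finset.sum_congr rfl fun i _ => ?_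
        refine setIntegral_congr_fun (c i).open_target.measurableSet fun w hw => ?_
        rw [chart_independent_symm hinv (hcm i) hw]
        rfl
    _ = 0 := by
        simp only [hterm]
        rw [← Finset.mul_sum, ← integral_finsetSum _ fun i _ =>
          (integral_areaMeasure_of_tsupport hf (hcm i) (hqc i) (hqs i)).1]
        simp only [hsum, integral_zero, mul_zero]

theorem integrable_energy (hf : IsConformalImmersion f) :
    Integrable (fun p => meanCurvature f p ^ 2 + 5 / 16 * tangentSectional f p - 1 / 4)
      (areaMeasure f) := by
  obtain ⟨t, ht⟩ := isCompact_univ.elim_finite_subcover (fun p : M => (chartAt ℂ p).source)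
    (fun p => (chartAt ℂ p).open_source) fun p _ => Set.mem_iUnion.2 ⟨p, mem_chart_source ℂ p⟩
  set c : t → OpenPartialHomeomorph M ℂ := fun i => chartAt ℂ (i : M) with hc
  obtain ⟨ρ, hρ⟩ := PartitionOfUnity.exists_isSubordinate isClosed_univ
    (fun i => (c i).source) (fun i => (c i).open_source)
    (by simpa [Set.iUnion_subtype, hc] using ht)
  have h1 := continuous_of_local (meanCurvature_invariant hf) fun e he =>
    (conformalOn_inParam hf he).continuousOn_meanCurvatureAt
  have h2 := continuous_of_local (tangentSectional_invariant hf) fun e he =>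
    (conformalOn_inParam hf he).continuousOn_tangentSectionalAt
  exact (integral_areaMeasure hf (fun i => chartAt_mem_localParams _) ρ hρ
    (((h1.pow 2).add (h2.const_mul (5 / 16))).sub continuous_const)).1

/-- Each summand is a local integral of `ρ i` times the global energy density, whatever spinor and
potentials were chosen. The sum is therefore the area integral of that density, and its imaginary
part vanishes. -/
theorem eq_of_isEnergy (hf : IsConformalImmersion f) {E : ℂ} (hE : IsEnergy f E) :
    E = ((1 / 4 * ∫ p, (meanCurvature f p ^ 2 + 5 / 16 * tangentSectional f p - 1 / 4)
      ∂(areaMeasure f) : ℝ) : ℂ) := by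
  obtain ⟨n, c, ψ₁, ψ₂, U, V, ρ, hc, hρ, rfl⟩ := hE
  have hinv := energyDensity_invariant hf
  have hcont := continuous_of_local hinv fun e he =>
    (conformalOn_inParam hf he).continuousOn_energyDensityAt
  have heq := (integral_areaMeasure hf (fun i => (hc i).1) ρ hρ hcont).2
  obtain ⟨hk1, hk2⟩ := integral_meanCurvature_mul_unitNormal hf
  have hi := integrable_energy hf
  calc _ = ∑ i, ∫ w in (c i).target, firstForm (inParam f (c i)) w 1 1 •
        (ρ i ((c i).symm w) • energyDensity f ((c i).symm w)) := by
        refine Finset.sum_congr rfl fun i _ => ?_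
        refine setIntegral_congr_fun (c i).open_target.measurableSet fun w hw => ?_
        simp only [energyDensity]
        rw [chart_independent_symm hinv (hc i).1 hw, (conformalOn_inParam hf (hc i).1).potential_mul
          (hc i).2.1 (hc i).2.2 hw, Complex.real_smul, Complex.real_smul]
        ring
    _ = ∫ p, energyDensity f p ∂(areaMeasure f) := heq.symm
    _ = ∫ p, (((1 / 4 * (meanCurvature f p ^ 2 + 5 / 16 * tangentSectional f p - 1 / 4) : ℝ) : ℂ) -
          Complex.I * ((5 / 8 * (meanCurvature f p *
            unitNormal (inParam f (chartAt ℂ p)) (chartAt ℂ p p) 2) : ℝ) : ℂ))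
          ∂(areaMeasure f) := rfl
    _ = _ := by
        have hA : Integrable (fun p => ((1 / 4 * (meanCurvature f p ^ 2 +
            5 / 16 * tangentSectional f p - 1 / 4) : ℝ) : ℂ)) (areaMeasure f) :=
          (hi.const_mul (1 / 4)).ofReal
        have hB : Integrable (fun p => Complex.I * ((5 / 8 * (meanCurvature f p *
            unitNormal (inParam f (chartAt ℂ p)) (chartAt ℂ p p) 2) : ℝ) : ℂ)) (areaMeasure f) :=
          (hk1.const_mul (5 / 8)).ofReal.const_mul Complex.I
        refine (integral_sub hA hB).trans ?_
        rw [integral_const_mul, integral_complex_ofReal, integral_complex_ofReal,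
          integral_const_mul, integral_const_mul, hk2]
        simp

end SLTilde

theorem mainTheorem10 {M : Type*} [TopologicalSpace M] [T2Space M] [CompactSpace M]
    [ChartedSpace ℂ M] [IsManifold 𝓘(ℂ) ω M] [MeasurableSpace M] [BorelSpace M]
    (f : M → SLTilde) (hf : IsConformalImmersion f) :
    MeasureTheory.Integrable
      (fun p => meanCurvature f p ^ 2 + 5 / 16 * tangentSectional f p - 1 / 4) (areaMeasure f) ∧
    ∀ E : ℂ, IsEnergy f E ↔
      E = ((1 / 4 * ∫ p, (meanCurvature f p ^ 2 + 5 / 16 * tangentSectional f p - 1 / 4)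
        ∂(areaMeasure f) : ℝ) : ℂ) := by
  refine ⟨integrable_energy hf, fun E => ⟨eq_of_isEnergy hf, ?_⟩⟩
  -- Some energy value exists, and every energy value equals the right-hand side.
  rintro rfl
  obtain ⟨E, hE⟩ := exists_isEnergy hf
  rwa [← eq_of_isEnergy hf hE]
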